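/- Let $(M,g)$ be a complete, connected, non-compact $n$-dimensional Riemannian manifold with distance function $d$, and let $\Delta=-\operatorname{div}\operatorname{grad}$. Assume that $M$ is harmonic: for each $p\in M$ the density $\sqrt{|\det(g_{ij})|}$ in a normal coordinate neighbourhood of $p$ depends only on the distance to $p$. Let $\lambda\neq 0$ and $c$ be real numbers. An averaged eigenfunction around $p$ for $\lambda$ is a smooth $f:M\to\mathbb R$ with $\Delta f=\lambda f$ which arises from some smooth solution $h$ of $\Delta h=\lambda h$ by averaging around $p$: $f(q)$ is the mean of $h(\exp_p(d(p,q)u))$ over the unit vectors $u\in T_pM$. Assume that for every $p\in M$ there is a nonzero averaged eigenfunction around $p$ for $\lambda$, and that every averaged eigenfunction around $p$ for $\lambda$ is a constant multiple of $$f_p=\cosh d(p,\cdot)+c .$$ Let $V_\lambda=\operatorname{span}\{f_p: p\in M\}$, let $B$ be the symmetric bilinear form on $V_\lambda$ determined by $B(f_p,h)=h(p)$ for $p\in M$, $h\in V_\lambda$, and for a unit speed geodesic $\gamma:\mathbb R\to M$ let $V_\gamma=\operatorname{span}\{f_{\gamma(t)}:t\in\mathbb R\}\subseteq V_\lambda$.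 Suppose that for every geodesic $\gamma$ the restriction of $B$ to $V_\gamma$ is nondegenerate. Then $M$ is a symmetric space: for every $p\in M$ there is a Riemannian isometry $s_p:M\to M$ which fixes $p$, has differential $-\mathrm{id}$ at $p$, and satisfies $s_p(\gamma(t))=\gamma(-t)$ for every geodesic $\gamma$ with $\gamma(0)=p$. Moreover, the geodesic involution $s_p$ is obtained from a reflection of $V_\lambda$. For every $p\in M$ and $v\in T_pM$, the function $q\mapsto d(f_q)_p(v)$ (the derivative of $x\mapsto f_x$ at $p$ in direction $v$) lies in $V_\lambda$. Let $T_pM\subseteq V_\lambda$ also denote the space of these functions, and $N_p$ its $B$-orthogonal complement in $V_\lambda$. Then $V_\lambda=N_p\oplus T_pM$, and the reflection $\tau_p$ of $V_\lambda$ in $N_p$ (the identity on $N_p$, minus the identity on $T_pM$) preserves $B$ and satisfies $\tau_p(f_q)=f_{s_p(q)}$ for all $q\in M$. -/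

import Mathlib

open Set MeasureTheory Bundle
open scoped Manifold ContDiff

noncomputable section

/-! ## Riemannian geometry: geodesics, exponential map, normal coordinates, density, Laplacian

`M` is an `n`-dimensional Riemannian manifold without boundary; its metric tensor is the inner
product on the tangent spaces and its distance is the Riemannian distance. -/

section Riemannian

/-- Unit speed geodesics, parametrized by the whole real line: curves which locally realize
the Riemannian distance. -/
def IsGeodesic {M : Type*} [MetricSpace M] (γ : ℝ → M) : Prop :=
  ∀ t : ℝ, ∃ ε > 0, ∀ s ∈ Ioo (t - ε) (t + ε), ∀ s' ∈ Ioo (t - ε) (t + ε),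
    dist (γ s) (γ s') = |s - s'|

variable {n : ℕ} {M : Type*} [MetricSpace M] [ChartedSpace (EuclideanSpace ℝ (Fin n)) M]

/-- The curve `γ` passes through `p` at time `0` with velocity `u`. -/
def HasInitialVelocity (γ : ℝ → M) (p : M) (u : TangentSpace (𝓡 n) p) : Prop :=
  γ 0 = p ∧
    (mfderiv 𝓘(ℝ, ℝ) (𝓡 n) γ 0 (1 : ℝ) : EuclideanSpace ℝ (Fin n)) =
      (u : EuclideanSpace ℝ (Fin n))

/-- The tangent spaces have dimension `n`. -/
theorem finrank_tangentSpace (p : M) :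
    Module.finrank ℝ (TangentSpace (𝓡 n) p) = n := by
  change Module.finrank ℝ (EuclideanSpace ℝ (Fin n)) = n
  simp

variable [RiemannianBundle (fun x : M => TangentSpace (𝓡 n) x)]

/-- `e` is the exponential map at `p`: for each unit vector `u` at `p`, the curve `t ↦ e (t u)` is
the unit speed geodesic issuing from `p` with velocity `u`. -/
def IsExpMap (p : M) (e : TangentSpace (𝓡 n) p → M) : Prop :=
  ∀ u : TangentSpace (𝓡 n) p, ‖u‖ = 1 →
    IsGeodesic (fun t : ℝ => e (t • u)) ∧ HasInitialVelocity (fun t : ℝ => e (t • u)) p u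

open Classical in
/-- The exponential map at `p`. On a complete Riemannian manifold (of dimension at least `1`)
there is exactly one map with the property `IsExpMap p`. -/
def expMap (p : M) : TangentSpace (𝓡 n) p → M :=
  if h : ∃ e : TangentSpace (𝓡 n) p → M, IsExpMap p e then h.choose else fun _ => p

/-- An orthonormal frame of the tangent space at `p`. -/
def orthoFrame (p : M) : OrthonormalBasis (Fin n) ℝ (TangentSpace (𝓡 n) p) :=
  haveI : FiniteDimensional ℝ (TangentSpace (𝓡 n) p) :=
    inferInstanceAs (FiniteDimensional ℝ (EuclideanSpace ℝ (Fin n)))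
  (stdOrthonormalBasis ℝ (TangentSpace (𝓡 n) p)).reindex (finCongr (finrank_tangentSpace p))

/-- (The inverse of) a normal coordinate system centred at `p`: a linear isometry of `ℝⁿ` with
the tangent space at `p`, followed by the exponential map. -/
def normalCoord (p : M) (v : EuclideanSpace ℝ (Fin n)) : M :=
  expMap p ((orthoFrame p).repr.symm v)

/-- The matrix `(g_ij)` of the metric tensor in the parametrization `ψ` of (a part of) `M`,
at the point with coordinates `y`. -/
def metricMatrix (ψ : EuclideanSpace ℝ (Fin n) → M) (y : EuclideanSpace ℝ (Fin n)) :
    Matrix (Fin n) (Fin n) ℝ :=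
  Matrix.of fun i j =>
    inner ℝ (mfderiv (𝓡 n) (𝓡 n) ψ y (EuclideanSpace.single i (1 : ℝ)))
      (mfderiv (𝓡 n) (𝓡 n) ψ y (EuclideanSpace.single j (1 : ℝ)))

/-- The density function `ω_p = √|det (g_ij)|` in normal coordinates centred at `p`. -/
def density (p : M) (v : EuclideanSpace ℝ (Fin n)) : ℝ :=
  √|(metricMatrix (normalCoord p) v).det|

variable (n M) in
/-- `M` is harmonic: around each point `p`, the density function `ω_p` in a normal coordinate
neighbourhood of `p` depends only on the geodesic distance to `p`. -/
def IsHarmonic : Prop :=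
  ∀ p : M, ∃ ε > 0, ∃ w : ℝ → ℝ, ∀ v : EuclideanSpace ℝ (Fin n), ‖v‖ < ε →
    density p v = w (dist p (normalCoord p v))

/-- The Laplacian `Δ f = - div grad f`, i.e. in local coordinates
`Δ f = - (det g)^(-1/2) ∑ i, ∂_i ((det g)^(1/2) ∑ j, g^{ij} ∂_j f)`,
computed at `x` in the preferred chart at `x`. -/
def laplaceBeltrami (n : ℕ) {M : Type*} [MetricSpace M] [ChartedSpace (EuclideanSpace ℝ (Fin n)) M]
    [RiemannianBundle (fun x : M => TangentSpace (𝓡 n) x)] (f : M → ℝ) (x : M) : ℝ :=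
  let φ := extChartAt (𝓡 n) x;
  let g := metricMatrix (n := n) φ.symm;
  -((√(g (φ x)).det)⁻¹ *
    ∑ i, fderiv ℝ (fun y => √(g y).det *
        ∑ j, (g y)⁻¹ i j * fderiv ℝ (f ∘ φ.symm) y (EuclideanSpace.single j 1))
      (φ x) (EuclideanSpace.single i 1))

/-- `f` is a smooth solution of `Δ f = lam f` on `M`. -/
def IsEigenfunction (n : ℕ) {M : Type*} [MetricSpace M]
    [ChartedSpace (EuclideanSpace ℝ (Fin n)) M]
    [RiemannianBundle (fun x : M => TangentSpace (𝓡 n) x)] (lam : ℝ) (f : M → ℝ) : Prop :=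
  ContMDiff (𝓡 n) 𝓘(ℝ, ℝ) ∞ f ∧ ∀ x, laplaceBeltrami n f x = lam * f x

/-- The average of `f` around `p`: the function whose value at `q` is the mean of `f` over the
geodesic sphere around `p` through `q`, with respect to the uniform probability measure on
directions at `p` (in a harmonic manifold the Riemannian measure of a geodesic sphere is a constant
multiple of the measure on directions). -/
def sphericalMean (n : ℕ) {M : Type*} [MetricSpace M] [ChartedSpace (EuclideanSpace ℝ (Fin n)) M]
    [RiemannianBundle (fun x : M => TangentSpace (𝓡 n) x)] (f : M → ℝ) (p q : M) : ℝ :=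
  ⨍ u : Metric.sphere (0 : EuclideanSpace ℝ (Fin n)) 1,
    f (normalCoord p (dist p q • (u : EuclideanSpace ℝ (Fin n))))
    ∂(volume : Measure (EuclideanSpace ℝ (Fin n))).toSphere

/-- Averaged eigenfunctions around `p` for `lam`: eigenfunctions which arise by averaging an
eigenfunction around `p` (these are radial around `p`). -/
def IsAveragedEigenfunction (n : ℕ) {M : Type*} [MetricSpace M]
    [ChartedSpace (EuclideanSpace ℝ (Fin n)) M]
    [RiemannianBundle (fun x : M => TangentSpace (𝓡 n) x)] (lam : ℝ) (p : M) (f : M → ℝ) : Prop :=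
  IsEigenfunction n lam f ∧ ∃ h : M → ℝ, IsEigenfunction n lam h ∧ f = sphericalMean n h p

/-- Riemannian isometries: diffeomorphisms preserving the metric tensor. -/
def IsRiemannianIsometry (s : M ≃ₘ⟮𝓡 n, 𝓡 n⟯ M) : Prop :=
  ∀ (x : M) (u v : TangentSpace (𝓡 n) x),
    inner ℝ (mfderiv (𝓡 n) (𝓡 n) s x u) (mfderiv (𝓡 n) (𝓡 n) s x v) = inner ℝ u v

/-- `s` is the geodesic involution at `p`: it fixes `p`, its differential at `p` is `-id`, and it
reverses the geodesics through `p`. -/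
def IsGeodesicInvolution {n : ℕ} {M : Type*} [MetricSpace M]
    [ChartedSpace (EuclideanSpace ℝ (Fin n)) M] (p : M) (s : M ≃ₘ⟮𝓡 n, 𝓡 n⟯ M) : Prop :=
  s p = p ∧
  (∀ v : TangentSpace (𝓡 n) p,
    (mfderiv (𝓡 n) (𝓡 n) s p v : EuclideanSpace ℝ (Fin n)) = -(v : EuclideanSpace ℝ (Fin n))) ∧
  ∀ γ : ℝ → M, IsGeodesic γ → γ 0 = p → ∀ t, s (γ t) = γ (-t)

variable (n M) in
/-- Riemannian symmetric spaces: at every point the geodesic involution is a globally defined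
isometry. -/
def IsSymmetricSpace : Prop :=
  ∀ p : M, ∃ s : M ≃ₘ⟮𝓡 n, 𝓡 n⟯ M, IsRiemannianIsometry s ∧ IsGeodesicInvolution p s

end Riemannian

/-! ## The functions `f_p = cosh r_p + c`, the space `V_λ` they span, and the form `B` -/

section Form

variable {M : Type*} [MetricSpace M]

/-- The function `f_p = cosh r_p + c`, where `r_p` is the distance to `p`. -/
def coshFun (c : ℝ) (p : M) : M → ℝ := fun q => Real.cosh (dist p q) + c

variable (M) in
/-- The space `V_λ`, spanned by the functions `f_p`, `p ∈ M`. -/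
def radialSpan (c : ℝ) : Submodule ℝ (M → ℝ) :=
  Submodule.span ℝ (range (coshFun c : M → M → ℝ))

/-- The map `Φ : M → V_λ`, `p ↦ f_p`. -/
def embed (c : ℝ) (p : M) : radialSpan M c :=
  ⟨coshFun c p, Submodule.subset_span (mem_range_self p)⟩

theorem coshFun_symm (c : ℝ) (p q : M) : coshFun c p q = coshFun c q p := by
  simp [coshFun, dist_comm]

/-- `∑ a_p δ_p ↦ (h ↦ ∑ a_p h(p))`, a linear map into the dual of `V_λ`. -/
def evalSum (c : ℝ) : (M →₀ ℝ) →ₗ[ℝ] radialSpan M c →ₗ[ℝ] ℝ :=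
  Finsupp.linearCombination ℝ fun p => (LinearMap.proj p).comp (radialSpan M c).subtype

theorem evalSum_apply (c : ℝ) (a : M →₀ ℝ) (h : radialSpan M c) :
    evalSum c a h = a.sum fun p r => r * (h : M → ℝ) p := by
  simp [evalSum, Finsupp.linearCombination_apply, Finsupp.sum, LinearMap.sum_apply]

theorem evalSum_eq_zero (c : ℝ) :
    LinearMap.ker (Finsupp.linearCombination ℝ (coshFun c : M → M → ℝ)) ≤
      LinearMap.ker (evalSum (M := M) c) := by
  intro a ha
  rw [LinearMap.mem_ker] at ha ⊢
  ext ⟨h, hh⟩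
  rw [evalSum_apply]
  change (a.sum fun p r => r * h p) = 0
  induction hh using Submodule.span_induction with
  | mem x hx =>
    obtain ⟨q, rfl⟩ := hx
    have := congrFun ha q
    simpa [Finsupp.linearCombination_apply, Finsupp.sum, coshFun_symm c q] using this
  | zero => simp
  | add x y _ _ hx hy =>
    simp only [Finsupp.sum, Pi.add_apply, mul_add, Finset.sum_add_distrib] at *
    rw [hx, hy, add_zero]
  | smul r x _ hx =>
    simp only [Finsupp.sum, Pi.smul_apply, smul_eq_mul, mul_left_comm _ r, ← Finset.mul_sum] at *
    rw [hx, mul_zero]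

/-- The bilinear form `B` on `V_λ`: `B (∑ a_p f_p, h) = ∑ a_p h(p)`. -/
def formB (c : ℝ) : LinearMap.BilinForm ℝ (radialSpan M c) :=
  ((LinearMap.ker (Finsupp.linearCombination ℝ (coshFun c : M → M → ℝ))).liftQ
      (evalSum c) (evalSum_eq_zero c)) ∘ₗ
    (Finsupp.linearCombination ℝ (coshFun c : M → M → ℝ)).quotKerEquivRange.symm.toLinearMap ∘ₗ
    (LinearEquiv.ofEq (radialSpan M c) _ (Finsupp.range_linearCombination _).symm).toLinearMap

/-- The property characterizing `B`: `B (f_p, h) = h(p)`. -/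
theorem formB_embed (c : ℝ) (p : M) (h : radialSpan M c) :
    formB c (embed c p) h = (h : M → ℝ) p := by
  have key : (Finsupp.linearCombination ℝ (coshFun c : M → M → ℝ)).quotKerEquivRange.symm
      (LinearEquiv.ofEq (radialSpan M c) _ (Finsupp.range_linearCombination _).symm (embed c p))
      = Submodule.Quotient.mk (Finsupp.single p 1) := by
    rw [LinearEquiv.symm_apply_eq]
    apply Subtype.ext
    simp only [LinearMap.quotKerEquivRange_apply_mk, Finsupp.linearCombination_single, one_smul]
    rfl
  simp only [formB, LinearMap.comp_apply, LinearEquiv.coe_coe]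
  rw [key]
  change evalSum c (Finsupp.single p 1) h = _
  simp [evalSum_apply]

/-- `V_γ`, the subspace of `V_λ` spanned by the functions `f_{γ(t)}`, `t ∈ ℝ`. -/
def curveSpan (c : ℝ) (γ : ℝ → M) : Submodule ℝ (radialSpan M c) :=
  Submodule.span ℝ (range fun t => embed c (γ t))

/-- The differential at `p` of `Φ : x ↦ f_x`, as a map into functions on `M`: the derivative of
`Φ` in direction `v` is the function whose value at `q` is the derivative of `x ↦ f_x(q)` at `p`
in direction `v`. -/
def dEmbed (n : ℕ) {M : Type*} [MetricSpace M] [ChartedSpace (EuclideanSpace ℝ (Fin n)) M]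
    (c : ℝ) (p : M) : TangentSpace (𝓡 n) p →ₗ[ℝ] (M → ℝ) :=
  { toFun := fun v q => mfderiv (𝓡 n) 𝓘(ℝ, ℝ) (fun x : M => coshFun c x q) p v
    map_add' := fun u v => funext fun q =>
      map_add (mfderiv (𝓡 n) 𝓘(ℝ, ℝ) (fun x : M => coshFun c x q) p) u v
    map_smul' := fun r v => funext fun q =>
      map_smul (mfderiv (𝓡 n) 𝓘(ℝ, ℝ) (fun x : M => coshFun c x q) p) r v }

/-- The tangent space `T_pM`, viewed inside `V_λ` by means of the differential of `Φ`. -/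
def tangentIn (n : ℕ) {M : Type*} [MetricSpace M] [ChartedSpace (EuclideanSpace ℝ (Fin n)) M]
    (c : ℝ) (p : M) : Submodule ℝ (radialSpan M c) :=
  (LinearMap.range (dEmbed n c p)).comap (radialSpan M c).subtype

/-- `N_p`, the orthogonal complement of `T_pM` in `V_λ` with respect to `B`. -/
def normalIn (n : ℕ) {M : Type*} [MetricSpace M] [ChartedSpace (EuclideanSpace ℝ (Fin n)) M]
    (c : ℝ) (p : M) : Submodule ℝ (radialSpan M c) :=
  (formB c).orthogonal (tangentIn n c p)

/-- `τ` is the `B`-reflection of `V_λ` in `N_p`: the space `V_λ` is the direct sum of `N_p` and its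
`B`-orthogonal `T_pM`, and `τ` is the identity on `N_p` and minus the identity on `T_pM`. -/
def IsReflection (n : ℕ) {M : Type*} [MetricSpace M] [ChartedSpace (EuclideanSpace ℝ (Fin n)) M]
    (c : ℝ) (p : M) (τ : radialSpan M c ≃ₗ[ℝ] radialSpan M c) : Prop :=
  IsCompl (normalIn n c p) (tangentIn n c p) ∧
    (∀ h ∈ normalIn n c p, τ h = h) ∧ ∀ h ∈ tangentIn n c p, τ h = -h

end Form

end

noncomputable section

section Metric

open Metric Filter Topology

variable {X : Type*} [MetricSpace X]

/-- Points can be found approximately between any two given points, at any given position. -/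
def HasApproxBetween (X : Type*) [MetricSpace X] : Prop :=
  ∀ (p q : X) (t ε : ℝ), 0 ≤ t → t ≤ dist p q → 0 < ε →
    ∃ z, dist p z = t ∧ dist z q ≤ dist p q - t + ε

theorem HasApproxBetween.exists_near (h : HasApproxBetween X) {p q : X} {r s : ℝ} (hr : 0 ≤ r)
    (hs : 0 < s) (hq : dist p q < r + s) : ∃ z, dist p z ≤ r ∧ dist z q < s := by
  rcases le_or_gt (dist p q) r with h1 | h1
  · exact ⟨q, h1, by simpa using hs⟩
  · obtain ⟨z, hz1, hz2⟩ := h p q r ((r + s - dist p q) / 2) hr h1.le (by linarith)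
    exact ⟨z, hz1.le, by linarith⟩

/-- The Hopf–Rinow theorem for complete locally compact length spaces. -/
theorem HasApproxBetween.isCompact_closedBall [CompleteSpace X] [LocallyCompactSpace X]
    (h : HasApproxBetween X) (p : X) (r : ℝ) : IsCompact (closedBall p r) := by
  by_contra hr
  have hmono : ∀ a b : ℝ, a ≤ b → IsCompact (closedBall p b) → IsCompact (closedBall p a) :=
    fun a b hab hb => hb.of_isClosed_subset isClosed_closedBall (closedBall_subset_closedBall hab)
  let S : Set ℝ := {a | IsCompact (closedBall p a)}
  have h0 : (0 : ℝ) ∈ S := by simp [S]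
  have hbdd : BddAbove S := ⟨r, fun a ha => by
    by_contra hlt
    exact hr (hmono r a (not_le.1 hlt).le ha)⟩
  set R := sSup S with hR
  have hR0 : 0 ≤ R := le_csSup hbdd h0
  have hlt : ∀ a < R, IsCompact (closedBall p a) := fun a ha => by
    obtain ⟨b, hb, hab⟩ := exists_lt_of_lt_csSup ⟨0, h0⟩ ha
    exact hmono a b hab.le hb
  have hRc : IsCompact (closedBall p R) := by
    rcases hR0.eq_or_lt with h00 | hpos
    · rw [← h00]; exact h0
    refine isCompact_iff_totallyBounded_isComplete.2 ⟨?_, isClosed_closedBall.isComplete⟩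
    rw [Metric.totallyBounded_iff]
    intro ε hε
    set δ := min (ε / 4) R with hδ
    have hδ0 : 0 < δ := lt_min (by linarith) hpos
    have hδR : δ ≤ R := min_le_right _ _
    have hδε : δ ≤ ε / 4 := min_le_left _ _
    obtain ⟨t, ht, hcov⟩ := Metric.totallyBounded_iff.1 (hlt (R - δ) (by linarith)).totallyBounded
      (ε / 2) (by linarith)
    refine ⟨t, ht, fun q hq => ?_⟩
    rw [mem_closedBall'] at hq
    obtain ⟨z, hz1, hz2⟩ := h.exists_near (r := R - δ) (s := 2 * δ) (by linarith) (by linarith)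
      (show dist p q < R - δ + 2 * δ by linarith)
    obtain ⟨y, hy, hzy⟩ := mem_iUnion₂.1 (hcov (show z ∈ closedBall p (R - δ) by
      rwa [mem_closedBall']))
    refine mem_iUnion₂.2 ⟨y, hy, ?_⟩
    rw [mem_ball] at hzy ⊢
    have := dist_triangle q z y
    rw [dist_comm q z] at this
    linarith
  obtain ⟨K, hK, hKs⟩ := exists_compact_superset hRc
  obtain ⟨δ, hδ, hδK⟩ := hRc.exists_thickening_subset_open isOpen_interior hKs
  have : R + δ / 2 ∈ S := by
    refine hK.of_isClosed_subset isClosed_closedBall fun q hq => interior_subset (hδK ?_)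
    rw [mem_closedBall'] at hq
    obtain ⟨z, hz1, hz2⟩ := h.exists_near (r := R) (s := δ) hR0 hδ
      (show dist p q < R + δ by linarith)
    rw [mem_thickening_iff]
    exact ⟨z, by rwa [mem_closedBall'], by rwa [dist_comm]⟩
  have := le_csSup hbdd this
  linarith

theorem HasApproxBetween.properSpace [CompleteSpace X] [LocallyCompactSpace X]
    (h : HasApproxBetween X) : ProperSpace X :=
  ⟨h.isCompact_closedBall⟩

theorem HasApproxBetween.exists_between [ProperSpace X] (h : HasApproxBetween X) (p q : X) {t : ℝ}
    (ht : 0 ≤ t) (htd : t ≤ dist p q) : ∃ z, dist p z = t ∧ dist z q = dist p q - t := by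
  obtain ⟨z0, hz0, -⟩ := h p q t 1 ht htd one_pos
  obtain ⟨z, hz, hmin⟩ := (isCompact_sphere p t).exists_isMinOn ⟨z0, by rwa [mem_sphere']⟩
    (f := fun z => dist z q) (by fun_prop)
  rw [mem_sphere'] at hz
  refine ⟨z, hz, le_antisymm (le_of_forall_pos_le_add fun ε hε => ?_) ?_⟩
  · obtain ⟨w, hw1, hw2⟩ := h p q t ε ht htd hε
    exact (hmin (show w ∈ sphere p t by rwa [mem_sphere'])).trans hw2
  · have := dist_triangle p z q
    linarith

/-- Any two points lie, with prescribed parameters, on a curve realizing distances: the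
three-point version. -/
def HasThirdPoint (X : Type*) [MetricSpace X] : Prop :=
  ∀ (x y : X) (a b : ℝ), dist x y = |a - b| → ∀ t : ℝ, ∃ z, dist x z = |a - t| ∧ dist y z = |b - t|

/-- If distances can be extended beyond every point at unit rate, then third points exist. -/
theorem HasApproxBetween.hasThirdPoint [ProperSpace X] [Nontrivial X] (h : HasApproxBetween X)
    (hext : ∀ p q : X, p ≠ q → ∀ δ : ℝ, 0 ≤ δ → ∃ x, dist q x = δ ∧ dist p x = dist p q + δ) :
    HasThirdPoint X := by
  have hlt : ∀ (x y : X) (a b : ℝ), a < b → dist x y = b - a → ∀ t : ℝ,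
      ∃ z, dist x z = |a - t| ∧ dist y z = |b - t| := by
    intro x y a b hab hxy t
    have hne : x ≠ y := fun e => by rw [e, dist_self] at hxy; linarith
    rcases le_or_gt t a with hta | hta
    · obtain ⟨z, h1, h2⟩ := hext y x hne.symm (a - t) (by linarith)
      refine ⟨z, by rw [h1, abs_of_nonneg (by linarith)], ?_⟩
      rw [h2, dist_comm, hxy, abs_of_nonneg (by linarith)]; ring
    rcases le_or_gt t b with htb | htb
    · obtain ⟨z, h1, h2⟩ := h.exists_between x y (t := t - a) (by linarith) (by linarith)
      refine ⟨z, by rw [h1, abs_of_nonpos (by linarith)]; ring, ?_⟩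
      rw [dist_comm, h2, hxy, abs_of_nonneg (by linarith)]; ring
    · obtain ⟨z, h1, h2⟩ := hext x y hne (t - b) (by linarith)
      refine ⟨z, ?_, by rw [h1, abs_of_nonpos (by linarith)]; ring⟩
      rw [h2, hxy, abs_of_nonpos (by linarith)]; ring
  intro x y a b hxy t
  rcases lt_trichotomy a b with hab | hab | hab
  · exact hlt x y a b hab (by rw [hxy, abs_of_neg (by linarith)]; ring) t
  · subst hab
    have hxy' : x = y := by simpa using hxy
    subst hxy'
    obtain ⟨y, hy⟩ := exists_ne x
    have := dist_pos.2 hy.symm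
    obtain ⟨z, hz, -⟩ := hlt x y a (a + dist x y) (by linarith) (by ring) t
    exact ⟨z, hz, hz⟩
  · obtain ⟨z, h1, h2⟩ := hlt y x b a hab
      (by rw [dist_comm, hxy, abs_of_pos (by linarith)]) t
    exact ⟨z, h2, h1⟩

/-- The graph of a distance-preserving partial map from `ℝ`. -/
def IsLinearGraph (G : Set (ℝ × X)) : Prop :=
  ∀ z ∈ G, ∀ w ∈ G, dist z.2 w.2 = |z.1 - w.1|

theorem IsLinearGraph.exists_insert_finset (h : HasThirdPoint X) [Nonempty X] {G : Finset (ℝ × X)}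
    (hG : IsLinearGraph (G : Set (ℝ × X))) (t : ℝ) : ∃ x, ∀ z ∈ G, dist z.2 x = |z.1 - t| := by
  classical
  rcases G.eq_empty_or_nonempty with rfl | hne
  · exact ⟨Classical.arbitrary X, by simp⟩
  have squeeze : ∀ {u v w : ℝ × X} {x : X}, dist u.2 v.2 = |u.1 - v.1| →
      dist u.2 w.2 = |u.1 - w.1| → dist v.2 w.2 = |v.1 - w.1| → dist u.2 x = |u.1 - t| →
      dist v.2 x = |v.1 - t| → (w.1 ≤ u.1 → u.1 ≤ t → v.1 ≥ t → dist w.2 x = |w.1 - t|) ∧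
        (w.1 ≥ v.1 → u.1 ≤ t → v.1 ≥ t → dist w.2 x = |w.1 - t|) ∧
        (u.1 ≤ w.1 → w.1 ≤ v.1 → v.1 ≤ t → dist w.2 x = |w.1 - t|) ∧
        (u.1 ≤ w.1 → w.1 ≤ v.1 → t ≤ u.1 → dist w.2 x = |w.1 - t|) := by
    intro u v w x huv huw hvw hu hv
    have e1 := dist_triangle w.2 u.2 x
    have e2 := dist_triangle w.2 v.2 x
    have e3 := dist_triangle u.2 w.2 x
    have e4 := dist_triangle v.2 w.2 x
    have e5 := dist_triangle w.2 x u.2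
    have e6 := dist_triangle w.2 x v.2
    rw [dist_comm w.2 u.2, huw, hu] at e1
    rw [dist_comm w.2 v.2, hvw, hv] at e2
    rw [huw, hu] at e3
    rw [hvw, hv] at e4
    rw [dist_comm w.2 u.2, dist_comm x, huw, hu] at e5
    rw [dist_comm w.2 v.2, dist_comm x, hvw, hv] at e6
    refine ⟨fun a b c => ?_, fun a b c => ?_, fun a b c => ?_, fun a b c => ?_⟩ <;>
    · apply le_antisymm <;>
      · rcases abs_cases (u.1 - w.1) with ⟨_, _⟩ | ⟨_, _⟩ <;>
        rcases abs_cases (v.1 - w.1) with ⟨_, _⟩ | ⟨_, _⟩ <;>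
        rcases abs_cases (u.1 - t) with ⟨_, _⟩ | ⟨_, _⟩ <;>
        rcases abs_cases (v.1 - t) with ⟨_, _⟩ | ⟨_, _⟩ <;>
        rcases abs_cases (w.1 - t) with ⟨_, _⟩ | ⟨_, _⟩ <;> linarith
  obtain ⟨lo, hlo, hlo'⟩ := G.exists_min_image Prod.fst hne
  obtain ⟨hi, hhi, hhi'⟩ := G.exists_max_image Prod.fst hne
  have key : ∀ u ∈ G, ∀ v ∈ G, ∃ x, dist u.2 x = |u.1 - t| ∧ dist v.2 x = |v.1 - t| :=
    fun u hu v hv => h u.2 v.2 u.1 v.1 (hG u hu v hv) t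
  by_cases h1 : t ≤ lo.1
  · obtain ⟨x, hx1, hx2⟩ := key lo hlo hi hhi
    exact ⟨x, fun w hw => (squeeze (hG _ hlo _ hhi) (hG _ hlo _ hw) (hG _ hhi _ hw) hx1 hx2).2.2.2
      (hlo' w hw) (hhi' w hw) h1⟩
  by_cases h2 : hi.1 ≤ t
  · obtain ⟨x, hx1, hx2⟩ := key lo hlo hi hhi
    exact ⟨x, fun w hw => (squeeze (hG _ hlo _ hhi) (hG _ hlo _ hw) (hG _ hhi _ hw) hx1 hx2).2.2.1
      (hlo' w hw) (hhi' w hw) h2⟩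
  push Not at h1 h2
  obtain ⟨u, hu, hu'⟩ := (G.filter fun z => z.1 ≤ t).exists_max_image Prod.fst
    ⟨lo, by simp [hlo, h1.le]⟩
  obtain ⟨v, hv, hv'⟩ := (G.filter fun z => t ≤ z.1).exists_min_image Prod.fst
    ⟨hi, by simp [hhi, h2.le]⟩
  rw [Finset.mem_filter] at hu hv
  obtain ⟨x, hx1, hx2⟩ := key u hu.1 v hv.1
  refine ⟨x, fun w hw => ?_⟩
  have sq := squeeze (hG _ hu.1 _ hv.1) (hG _ hu.1 _ hw) (hG _ hv.1 _ hw) hx1 hx2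
  rcases le_total w.1 t with hwt | hwt
  · exact sq.1 (hu' w (by simp [hw, hwt])) hu.2 hv.2
  · exact sq.2.1 (hv' w (by simp [hw, hwt])) hu.2 hv.2

theorem IsLinearGraph.exists_insert [ProperSpace X] [Nonempty X] (h : HasThirdPoint X)
    {G : Set (ℝ × X)} (hG : IsLinearGraph G) (t : ℝ) : ∃ x, ∀ z ∈ G, dist z.2 x = |z.1 - t| := by
  rcases G.eq_empty_or_nonempty with rfl | ⟨z0, hz0⟩
  · exact ⟨Classical.arbitrary X, by simp⟩
  have hcl : ∀ z : G, IsClosed (sphere z.1.2 |z.1.1 - t|) := fun z => isClosed_sphere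
  obtain ⟨x, -, hx⟩ := (isCompact_sphere z0.2 |z0.1 - t|).inter_iInter_nonempty
    (fun z : G => sphere z.1.2 |z.1.1 - t|) hcl (by
      classical
      intro u
      obtain ⟨x, hx⟩ := IsLinearGraph.exists_insert_finset h
        (G := insert z0 (u.image Subtype.val)) (by
          intro z hz w hw
          refine hG z ?_ w ?_
          · simp only [Finset.coe_insert, Finset.coe_image, mem_insert_iff, mem_image] at hz
            rcases hz with rfl | ⟨y, -, rfl⟩
            exacts [hz0, y.2]
          · simp only [Finset.coe_insert, Finset.coe_image, mem_insert_iff, mem_image] at hw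
            rcases hw with rfl | ⟨y, -, rfl⟩
            exacts [hz0, y.2]) t
      refine ⟨x, ?_, mem_iInter₂.2 fun z hz => ?_⟩
      · rw [mem_sphere']; exact hx _ (by simp)
      · rw [mem_sphere']; exact hx _ (Finset.mem_insert_of_mem (Finset.mem_image_of_mem _ hz)))
  exact ⟨x, fun z hz => by
    have := mem_iInter.1 hx ⟨z, hz⟩
    rwa [mem_sphere'] at this⟩

/-- Partial distance-preserving curves extend to the whole real line. -/
theorem IsLinearGraph.exists_isometry [ProperSpace X] [Nonempty X] (h : HasThirdPoint X)
    {G : Set (ℝ × X)} (hG : IsLinearGraph G) :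
    ∃ γ : ℝ → X, Isometry γ ∧ ∀ z ∈ G, γ z.1 = z.2 := by
  obtain ⟨m, hGm, hm⟩ := zorn_subset_nonempty {G : Set (ℝ × X) | IsLinearGraph G} (by
    intro c hc hchain _
    refine ⟨⋃₀ c, ?_, fun s hs => subset_sUnion_of_mem hs⟩
    rintro z ⟨s, hs, hzs⟩ w ⟨s', hs', hws⟩
    rcases hchain.total hs hs' with hss | hss
    · exact hc hs' z (hss hzs) w hws
    · exact hc hs z hzs w (hss hws)) G hG
  have hmG : IsLinearGraph m := hm.prop
  have hex : ∀ t, ∃ x, (t, x) ∈ m := by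
    intro t
    obtain ⟨x, hx⟩ := hmG.exists_insert h t
    refine ⟨x, hm.mem_of_prop_insert (x := (t, x)) ?_⟩
    rintro z (rfl | hz) w (rfl | hw)
    · simp
    · rw [dist_comm, abs_sub_comm]; exact hx w hw
    · exact hx z hz
    · exact hmG z hz w hw
  choose γ hγ using hex
  refine ⟨γ, Isometry.of_dist_eq fun s t => ?_, fun z hz => ?_⟩
  · rw [Real.dist_eq]; exact hmG _ (hγ s) _ (hγ t)
  · have := hmG _ (hγ z.1) _ (hGm hz)
    simpa using this

end Metric
end

noncomputable section

section Length

open Metric Filter Topology Manifold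
open scoped ENNReal NNReal

variable {n : ℕ} {M : Type*} [MetricSpace M] [ChartedSpace (EuclideanSpace ℝ (Fin n)) M]
  [RiemannianBundle (fun x : M => TangentSpace (𝓡 n) x)]

/-- The differential of a real-valued function, as a continuous linear form. -/
def diffAt (g : M → ℝ) (p : M) : TangentSpace (𝓡 n) p →L[ℝ] ℝ :=
  mfderiv (𝓡 n) 𝓘(ℝ, ℝ) g p

/-- The velocity of a curve. -/
def velocity (γ : ℝ → M) (t : ℝ) : TangentSpace (𝓡 n) (γ t) :=
  mfderiv 𝓘(ℝ, ℝ) (𝓡 n) γ t (1 : ℝ)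

omit [RiemannianBundle (fun x : M => TangentSpace (𝓡 n) x)] in
theorem hasDerivAt_comp_curve {g : M → ℝ} {γ : ℝ → M} {t : ℝ}
    (hg : MDifferentiableAt (𝓡 n) 𝓘(ℝ, ℝ) g (γ t)) (hγ : MDifferentiableAt 𝓘(ℝ, ℝ) (𝓡 n) γ t) :
    HasDerivAt (g ∘ γ) (diffAt (n := n) g (γ t) (velocity γ t)) t := by
  have hd : HasFDerivAt (g ∘ γ) ((diffAt (n := n) g (γ t)).comp
      (show ℝ →L[ℝ] TangentSpace (𝓡 n) (γ t) from mfderiv 𝓘(ℝ, ℝ) (𝓡 n) γ t)) t :=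
    (HasMFDerivAt.comp t hg.hasMFDerivAt hγ.hasMFDerivAt).hasFDerivAt
  exact hd.hasDerivAt

variable (n M) in
theorem hasApproxBetween_of_riemannian [IsManifold (𝓡 n) ∞ M] [IsRiemannianManifold (𝓡 n) M] :
    HasApproxBetween M := by
  intro p q t ε ht htd hε
  have h1 : riemannianEDist (𝓡 n) p q < ENNReal.ofReal (dist p q + ε) := by
    rw [← IsRiemannianManifold.out (I := 𝓡 n) p q, edist_dist]
    exact (ENNReal.ofReal_lt_ofReal_iff (by positivity)).2 (by linarith)
  obtain ⟨γ, h0, h1, hγ, hlen, -⟩ := exists_lt_locally_constant_of_riemannianEDist_lt h1 zero_lt_one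
  have hcont : ContinuousOn (fun s => dist p (γ s)) (Icc 0 1) :=
    (continuous_const.dist hγ.continuous).continuousOn
  obtain ⟨s, hs, hst⟩ := intermediate_value_Icc zero_le_one hcont
    (show t ∈ Icc (dist p (γ 0)) (dist p (γ 1)) by rw [h0, h1, dist_self]; exact ⟨ht, htd⟩)
  refine ⟨γ s, hst, ?_⟩
  have e1 : edist p (γ s) ≤ pathELength (𝓡 n) γ 0 s := by
    rw [IsRiemannianManifold.out (I := 𝓡 n) p (γ s)]
    exact riemannianEDist_le_pathELength hγ.contMDiffOn h0 rfl hs.1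
  have e2 : edist (γ s) q ≤ pathELength (𝓡 n) γ s 1 := by
    rw [IsRiemannianManifold.out (I := 𝓡 n) (γ s) q]
    exact riemannianEDist_le_pathELength hγ.contMDiffOn rfl h1 hs.2
  have e3 : edist p (γ s) + edist (γ s) q < ENNReal.ofReal (dist p q + ε) := by
    refine (add_le_add e1 e2).trans_lt ?_
    rwa [pathELength_add hs.1 hs.2]
  rw [edist_dist, edist_dist, ← ENNReal.ofReal_add dist_nonneg dist_nonneg,
    ENNReal.ofReal_lt_ofReal_iff (by positivity)] at e3
  simp only at hst
  linarith

theorem enorm_sub_le_mul_pathELength {U : Set M} (hU : IsOpen U) {g : M → ℝ}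
    (hg : ContMDiffOn (𝓡 n) 𝓘(ℝ, ℝ) 1 g U) {C : ℝ≥0}
    (hC : ∀ y ∈ U, ∀ v : TangentSpace (𝓡 n) y, |diffAt g y v| ≤ C * ‖v‖)
    {γ : ℝ → M} (hγ : ContMDiff 𝓘(ℝ, ℝ) (𝓡 n) 1 γ) (hγU : ∀ t ∈ Icc (0 : ℝ) 1, γ t ∈ U) :
    ‖g (γ 1) - g (γ 0)‖ₑ ≤ C * pathELength (𝓡 n) γ 0 1 := by
  have hsm : ContMDiffOn 𝓘(ℝ, ℝ) 𝓘(ℝ, ℝ) 1 (g ∘ γ) (Icc 0 1) :=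
    hg.comp hγ.contMDiffOn hγU
  calc ‖g (γ 1) - g (γ 0)‖ₑ
    _ ≤ ∫⁻ t in Icc (0 : ℝ) 1, ‖derivWithin (g ∘ γ) (Icc 0 1) t‖ₑ := by
      apply enorm_sub_le_lintegral_derivWithin_Icc_of_contDiffOn_Icc _ zero_le_one
      rwa [← contMDiffOn_iff_contDiffOn]
    _ ≤ ∫⁻ t in Icc (0 : ℝ) 1, C * ‖mfderiv 𝓘(ℝ, ℝ) (𝓡 n) γ t 1‖ₑ := by
      rw [← restrict_Ioo_eq_restrict_Icc]
      apply setLIntegral_mono' measurableSet_Ioo (fun t ht ↦ ?_)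
      have ht' : t ∈ Icc (0 : ℝ) 1 := ⟨ht.1.le, ht.2.le⟩
      have hd := hasDerivAt_comp_curve (n := n) (g := g) (γ := γ) (t := t)
        (((hg _ (hγU t ht')).contMDiffAt (hU.mem_nhds (hγU t ht'))).mdifferentiableAt one_ne_zero)
        (hγ.mdifferentiable one_ne_zero t)
      rw [derivWithin_of_mem_nhds (Icc_mem_nhds ht.1 ht.2), hd.deriv]
      have := hC (γ t) (hγU t ht') (velocity γ t)
      rw [← ofReal_norm, ← ofReal_norm, ← ENNReal.ofReal_coe_nnreal,
        ← ENNReal.ofReal_mul C.coe_nonneg]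
      exact ENNReal.ofReal_le_ofReal this
    _ = C * pathELength (𝓡 n) γ 0 1 := by
      rw [lintegral_const_mul' _ _ ENNReal.coe_ne_top,
          pathELength_eq_lintegral_mfderiv_Icc]

theorem abs_sub_le_mul_dist [IsManifold (𝓡 n) ∞ M] [IsRiemannianManifold (𝓡 n) M] {p : M} {r : ℝ}
    {g : M → ℝ}
    (hg : ContMDiffOn (𝓡 n) 𝓘(ℝ, ℝ) 1 g (ball p r)) {C : ℝ≥0}
    (hC : ∀ y ∈ ball p r, ∀ v : TangentSpace (𝓡 n) y, |diffAt g y v| ≤ C * ‖v‖)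
    {x : M} (hx : x ∈ ball p r) : |g x - g p| ≤ C * dist p x := by
  rw [mem_ball'] at hx
  refine le_of_forall_gt_imp_ge_of_dense fun a ha => ?_
  have key : ∀ b, dist p x < b → b < r → |g x - g p| ≤ C * b := by
    intro b hb hbr
    have hb0 : 0 ≤ b := dist_nonneg.trans hb.le
    have h1 : riemannianEDist (𝓡 n) p x < ENNReal.ofReal b := by
      rw [← IsRiemannianManifold.out (I := 𝓡 n) p x, edist_dist]
      exact (ENNReal.ofReal_lt_ofReal_iff (dist_nonneg.trans_lt hb)).2 hb
    obtain ⟨γ, h0, h1, hγ, hlen, -⟩ :=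
      exists_lt_locally_constant_of_riemannianEDist_lt h1 zero_lt_one
    have hin : ∀ t ∈ Icc (0 : ℝ) 1, γ t ∈ ball p r := by
      intro t ht
      rw [mem_ball', ← ENNReal.ofReal_lt_ofReal_iff (by linarith [dist_nonneg (x := p) (y := x)]),
        ← edist_dist,
        IsRiemannianManifold.out (I := 𝓡 n) p (γ t)]
      calc _ ≤ pathELength (𝓡 n) γ 0 t :=
            riemannianEDist_le_pathELength hγ.contMDiffOn h0 rfl ht.1
        _ ≤ pathELength (𝓡 n) γ 0 1 := pathELength_mono le_rfl ht.2
        _ < ENNReal.ofReal b := hlen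
        _ ≤ _ := ENNReal.ofReal_le_ofReal hbr.le
    have := (enorm_sub_le_mul_pathELength isOpen_ball hg hC hγ hin).trans
      (mul_le_mul_right hlen.le _)
    rw [h0, h1, ← ofReal_norm, ← ENNReal.ofReal_coe_nnreal, ← ENNReal.ofReal_mul C.coe_nonneg,
      ENNReal.ofReal_le_ofReal_iff (by positivity)] at this
    simpa using this
  have hlim : Tendsto (fun b : ℝ => C * b) (𝓝[>] (dist p x)) (𝓝 (C * dist p x)) :=
    ((continuous_const.mul continuous_id).tendsto _).mono_left nhdsWithin_le_nhds
  refine (ge_of_tendsto hlim ?_).trans ha.le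
  filter_upwards [Ioo_mem_nhdsGT hx] with b hb
  exact key b hb.1 hb.2

end Length
end

noncomputable section

section LocalCoord

open Metric Filter Topology Manifold
open scoped ENNReal NNReal

variable {n : ℕ} {M : Type*} [MetricSpace M] [ChartedSpace (EuclideanSpace ℝ (Fin n)) M]

/-- The coordinate of `x` in the preferred chart at `p`, centred at `p`, as a tangent vector. -/
def localCoord (p x : M) : TangentSpace (𝓡 n) p :=
  (extChartAt (𝓡 n) p x - extChartAt (𝓡 n) p p : EuclideanSpace ℝ (Fin n))

/-- The point of coordinate `v` in the preferred chart at `p`, centred at `p`. -/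
def localPoint (p : M) (v : TangentSpace (𝓡 n) p) : M :=
  (extChartAt (𝓡 n) p).symm (extChartAt (𝓡 n) p p + (show EuclideanSpace ℝ (Fin n) from v))

/-- The derivative at `y` of the preferred chart at `p`. -/
def chartDiff (p y : M) : TangentSpace (𝓡 n) y →L[ℝ] TangentSpace (𝓡 n) p :=
  mfderiv (𝓡 n) 𝓘(ℝ, EuclideanSpace ℝ (Fin n)) (extChartAt (𝓡 n) p) y

@[simp] theorem localCoord_self (p : M) : localCoord (n := n) p p = 0 := sub_self _

@[simp] theorem localPoint_zero (p : M) : localPoint p (0 : TangentSpace (𝓡 n) p) = p := by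
  have : localPoint p (0 : TangentSpace (𝓡 n) p) =
    (extChartAt (𝓡 n) p).symm (extChartAt (𝓡 n) p p + 0) := rfl
  rw [this, add_zero, extChartAt_to_inv]

theorem continuousAt_localCoord (p : M) : ContinuousAt (localCoord (n := n) p) p :=
  (continuousAt_extChartAt (I := 𝓡 n) p).sub continuousAt_const

theorem tendsto_localCoord (p : M) : Tendsto (localCoord (n := n) p) (𝓝 p) (𝓝 0) := by
  simpa using (continuousAt_localCoord (n := n) p).tendsto

theorem continuousAt_localPoint (p : M) :
    ContinuousAt (localPoint (n := n) p) 0 := by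
  have h : ContinuousAt (extChartAt (𝓡 n) p).symm
      (extChartAt (𝓡 n) p p + (0 : EuclideanSpace ℝ (Fin n))) := by
    rw [add_zero]; exact continuousAt_extChartAt_symm p
  exact ContinuousAt.comp (f := fun v : EuclideanSpace ℝ (Fin n) => extChartAt (𝓡 n) p p + v) h
    (by fun_prop)

theorem tendsto_localPoint (p : M) : Tendsto (localPoint (n := n) p) (𝓝 0) (𝓝 p) := by
  simpa using (continuousAt_localPoint (n := n) p).tendsto

theorem eventually_add_mem_target (p : M) : ∀ᶠ v : EuclideanSpace ℝ (Fin n) in 𝓝 0,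
    extChartAt (𝓡 n) p p + v ∈ (extChartAt (𝓡 n) p).target := by
  have h : Tendsto (fun v : EuclideanSpace ℝ (Fin n) => extChartAt (𝓡 n) p p + v) (𝓝 0)
      (𝓝 (extChartAt (𝓡 n) p p)) := by
    have : ContinuousAt (fun v : EuclideanSpace ℝ (Fin n) => extChartAt (𝓡 n) p p + v) 0 := by
      fun_prop
    simpa [ContinuousAt] using this
  exact h (extChartAt_target_mem_nhds p)

theorem localCoord_localPoint {p : M} {v : EuclideanSpace ℝ (Fin n)}
    (hv : extChartAt (𝓡 n) p p + v ∈ (extChartAt (𝓡 n) p).target) :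
    localCoord (n := n) p (localPoint (n := n) p v) = v := by
  have : extChartAt (𝓡 n) p (localPoint (n := n) p v) = extChartAt (𝓡 n) p p + v :=
    (extChartAt (𝓡 n) p).right_inv hv
  change (extChartAt (𝓡 n) p (localPoint (n := n) p v) - extChartAt (𝓡 n) p p : EuclideanSpace ℝ (Fin n)) = v
  rw [this, add_sub_cancel_left]

theorem eventually_localCoord_localPoint (p : M) :
    ∀ᶠ v : TangentSpace (𝓡 n) p in 𝓝 0, localCoord p (localPoint p v) = v :=
  (eventually_add_mem_target (n := n) p).mono fun _ hv => localCoord_localPoint hv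

variable [IsManifold (𝓡 n) ∞ M]

theorem contMDiffOn_clm_localCoord (p : M) (α : TangentSpace (𝓡 n) p →L[ℝ] ℝ) :
    ContMDiffOn (𝓡 n) 𝓘(ℝ, ℝ) 1 (fun x => α (localCoord p x))
      (chartAt (EuclideanSpace ℝ (Fin n)) p).source := by
  have h1 : ContMDiffOn (𝓡 n) 𝓘(ℝ, EuclideanSpace ℝ (Fin n)) 1
      (fun x => extChartAt (𝓡 n) p x - extChartAt (𝓡 n) p p)
      (chartAt (EuclideanSpace ℝ (Fin n)) p).source :=
    (contMDiffOn_extChartAt (I := 𝓡 n) (n := 1)).sub contMDiffOn_const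
  exact (ContinuousLinearMap.contMDiff (show EuclideanSpace ℝ (Fin n) →L[ℝ] ℝ from α)).comp_contMDiffOn h1

theorem diffAt_clm_localCoord (p : M) (α : TangentSpace (𝓡 n) p →L[ℝ] ℝ) {y : M}
    (hy : y ∈ (chartAt (EuclideanSpace ℝ (Fin n)) p).source) (v : TangentSpace (𝓡 n) y) :
    diffAt (fun x => α (localCoord p x)) y v = α (chartDiff p y v) := by
  let α' : EuclideanSpace ℝ (Fin n) →L[ℝ] ℝ := α
  let G : EuclideanSpace ℝ (Fin n) → ℝ := fun z => α' (z - extChartAt (𝓡 n) p p)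
  have h1 : HasFDerivAt G α' (extChartAt (𝓡 n) p y) :=
    α'.hasFDerivAt.comp (f := fun z => z - extChartAt (𝓡 n) p p) _ ((hasFDerivAt_id _).sub_const _)
  have h2 := HasMFDerivAt.comp y h1.hasMFDerivAt
    (mdifferentiableAt_extChartAt (I := 𝓡 n) hy).hasMFDerivAt
  exact congrArg (fun L : TangentSpace (𝓡 n) y →L[ℝ] ℝ => L v) h2.mfderiv

variable [RiemannianBundle (fun x : M => TangentSpace (𝓡 n) x)]
  [IsContMDiffRiemannianBundle (𝓡 n) ∞ (EuclideanSpace ℝ (Fin n))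
      (fun x : M => TangentSpace (𝓡 n) x)]

variable (n M) in
theorem isContinuousRiemannianBundle_of_contMDiff :
    IsContinuousRiemannianBundle (EuclideanSpace ℝ (Fin n))
      (fun x : M => TangentSpace (𝓡 n) x) := by
  obtain ⟨g, hg, hg'⟩ := IsContMDiffRiemannianBundle.exists_contMDiff (IB := 𝓡 n) (n := ∞)
    (F := EuclideanSpace ℝ (Fin n)) (E := fun x : M => TangentSpace (𝓡 n) x)
  exact ⟨g, hg.continuous, hg'⟩

theorem eventually_norm_chartDiff_le (p : M) {r : ℝ} (hr : 1 < r) :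
    ∀ᶠ y in 𝓝 p, ∀ v : TangentSpace (𝓡 n) y, ‖chartDiff p y v‖ ≤ r * ‖v‖ := by
  have := isContinuousRiemannianBundle_of_contMDiff n M
  filter_upwards [eventually_norm_symmL_trivializationAt_self_comp_lt (EuclideanSpace ℝ (Fin n))
    (fun x : M => TangentSpace (𝓡 n) x) p hr,
    chart_source_mem_nhds (EuclideanSpace ℝ (Fin n)) p] with y hy hys v
  refine le_trans (le_of_eq ?_) (ContinuousLinearMap.le_of_opNorm_le _ hy.le v)
  congr 1
  rw [ContinuousLinearMap.comp_apply, TangentBundle.symmL_trivializationAt (mem_chart_source _ p),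
    TangentBundle.continuousLinearMapAt_trivializationAt hys]
  have h := mfderivWithin_range_extChartAt_symm (I := 𝓡 n) (x := p)
  exact (congrArg (fun L : EuclideanSpace ℝ (Fin n) →L[ℝ] EuclideanSpace ℝ (Fin n) =>
    L (chartDiff p y v)) h).symm

theorem eventually_norm_le_chartDiff (p : M) {r : ℝ} (hr : 1 < r) :
    ∀ᶠ y in 𝓝 p, ∀ v : TangentSpace (𝓡 n) y, ‖v‖ ≤ r * ‖chartDiff p y v‖ := by
  have := isContinuousRiemannianBundle_of_contMDiff n M
  filter_upwards [eventually_norm_symmL_trivializationAt_comp_self_lt (EuclideanSpace ℝ (Fin n))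
    (fun x : M => TangentSpace (𝓡 n) x) p hr,
    chart_source_mem_nhds (EuclideanSpace ℝ (Fin n)) p] with y hy hys v
  refine le_trans (le_of_eq ?_) (ContinuousLinearMap.le_of_opNorm_le _ hy.le (chartDiff p y v))
  congr 1
  rw [ContinuousLinearMap.comp_apply,
    TangentBundle.continuousLinearMapAt_trivializationAt (mem_chart_source _ p)]
  have h := mfderiv_extChartAt_self (I := 𝓡 n) (x := p)
  have h2 : mfderiv (𝓡 n) 𝓘(ℝ, EuclideanSpace ℝ (Fin n)) (extChartAt (𝓡 n) p) p (chartDiff p y v)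
      = chartDiff p y v :=
    congrArg (fun L : EuclideanSpace ℝ (Fin n) →L[ℝ] EuclideanSpace ℝ (Fin n) =>
      L (chartDiff p y v)) h
  have hb : y ∈ (trivializationAt (EuclideanSpace ℝ (Fin n)) (TangentSpace (𝓡 n)) p).baseSet := hys
  have h3 := (trivializationAt (EuclideanSpace ℝ (Fin n)) (TangentSpace (𝓡 n)) p).symmL_continuousLinearMapAt
    (R := ℝ) hb v
  rw [TangentBundle.continuousLinearMapAt_trivializationAt hys] at h3
  exact h3.symm.trans (congrArg
    ((trivializationAt (EuclideanSpace ℝ (Fin n)) (TangentSpace (𝓡 n)) p).symmL ℝ y) h2.symm)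

variable [IsRiemannianManifold (𝓡 n) M]

theorem eventually_norm_localCoord_le (p : M) {r : ℝ} (hr : 1 < r) :
    ∀ᶠ x in 𝓝 p, ‖localCoord (n := n) p x‖ ≤ r * dist p x := by
  obtain ⟨ρ, hρ, hball⟩ := Metric.eventually_nhds_iff_ball.1
    ((eventually_norm_chartDiff_le (n := n) p hr).and
      (chart_source_mem_nhds (EuclideanSpace ℝ (Fin n)) p))
  filter_upwards [ball_mem_nhds p hρ] with x hx
  rcases eq_or_ne (localCoord (n := n) p x) 0 with h0 | h0
  · rw [h0, norm_zero]; positivity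
  set u := localCoord (n := n) p x with hu
  let α : TangentSpace (𝓡 n) p →L[ℝ] ℝ := innerSL ℝ u
  have hα : ∀ w, |α w| ≤ ‖u‖ * ‖w‖ := fun w => abs_real_inner_le_norm u w
  have := abs_sub_le_mul_dist (n := n) (p := p) (r := ρ) (g := fun x => α (localCoord p x))
    ((contMDiffOn_clm_localCoord p α).mono fun y hy => (hball y hy).2)
    (C := ⟨‖u‖ * r, by positivity⟩) (fun y hy v => by
      rw [diffAt_clm_localCoord p α (hball y hy).2]
      refine (hα _).trans ?_
      change _ ≤ (‖u‖ * r) * ‖v‖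
      rw [mul_assoc]
      exact mul_le_mul_of_nonneg_left ((hball y hy).1 v) (norm_nonneg _)) hx
  rw [localCoord_self, map_zero, sub_zero, ← hu] at this
  have h2 : α u = ‖u‖ * ‖u‖ := real_inner_self_eq_norm_mul_norm u
  rw [h2, abs_of_nonneg (by positivity)] at this
  change _ ≤ ‖u‖ * r * dist p x at this
  rw [mul_assoc] at this
  exact le_of_mul_le_mul_left this (norm_pos_iff.2 h0)

theorem eventually_dist_localPoint_le (p : M) {r : ℝ} (hr : 1 < r) :
    ∀ᶠ v : TangentSpace (𝓡 n) p in 𝓝 0, dist p (localPoint p v) ≤ r * ‖v‖ := by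
  have hev : ∀ᶠ v : TangentSpace (𝓡 n) p in 𝓝 0,
      (∀ w : TangentSpace (𝓡 n) (localPoint p v), ‖w‖ ≤ r * ‖chartDiff p (localPoint p v) w‖) ∧
      extChartAt (𝓡 n) p p + (show EuclideanSpace ℝ (Fin n) from v) ∈ (extChartAt (𝓡 n) p).target :=
    ((tendsto_localPoint (n := n) p).eventually (eventually_norm_le_chartDiff p hr)).and
      (eventually_add_mem_target (n := n) p)
  obtain ⟨ρ, hρ, hball⟩ := Metric.eventually_nhds_iff_ball.1 hev
  filter_upwards [ball_mem_nhds _ hρ] with v hv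
  rw [mem_ball_zero_iff] at hv
  have hmem : ∀ t ∈ Icc (0 : ℝ) 1, t • v ∈ ball (0 : TangentSpace (𝓡 n) p) ρ := by
    intro t ht
    rw [mem_ball_zero_iff, norm_smul, Real.norm_of_nonneg ht.1]
    exact (mul_le_of_le_one_left (norm_nonneg _) ht.2).trans_lt hv
  let v' : EuclideanSpace ℝ (Fin n) := v
  let η : ℝ → EuclideanSpace ℝ (Fin n) := fun t => extChartAt (𝓡 n) p p + t • v'
  let γ : ℝ → M := fun t => localPoint p (t • v)
  have hγη : γ = (extChartAt (𝓡 n) p).symm ∘ η := rfl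
  have hηt : ∀ t ∈ Icc (0 : ℝ) 1, η t ∈ (extChartAt (𝓡 n) p).target :=
    fun t ht => (hball _ (hmem t ht)).2
  have hη : ContDiff ℝ 1 η := by fun_prop
  have hγ : ContMDiffOn 𝓘(ℝ, ℝ) (𝓡 n) 1 γ (Icc 0 1) :=
    (contMDiffOn_extChartAt_symm (I := 𝓡 n) (n := 1) p).comp hη.contMDiff.contMDiffOn hηt
  have hlen : riemannianEDist (𝓡 n) p (localPoint p v) ≤ pathELength (𝓡 n) γ 0 1 :=
    riemannianEDist_le_pathELength hγ (by simp [γ]) (by simp [γ]) zero_le_one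
  have hle : pathELength (𝓡 n) γ 0 1 ≤ ENNReal.ofReal (r * ‖v‖) := by
    rw [pathELength_eq_lintegral_mfderiv_Ioo]
    calc _ ≤ ∫⁻ t in Ioo (0 : ℝ) 1, ENNReal.ofReal (r * ‖v‖) := by
          apply setLIntegral_mono' measurableSet_Ioo (fun t ht ↦ ?_)
          have ht' : t ∈ Icc (0 : ℝ) 1 := ⟨ht.1.le, ht.2.le⟩
          rw [← ofReal_norm]
          refine ENNReal.ofReal_le_ofReal (((hball _ (hmem t ht')).1 (velocity γ t)).trans ?_)
          refine le_of_eq ?_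
          congr 2
          have hsrc : γ t ∈ (chartAt (EuclideanSpace ℝ (Fin n)) p).source := by
            have := (extChartAt (𝓡 n) p).map_target (hηt t ht')
            rwa [extChartAt_source] at this
          have hγt : MDifferentiableAt 𝓘(ℝ, ℝ) (𝓡 n) γ t :=
            (hγ.contMDiffAt (Icc_mem_nhds ht.1 ht.2)).mdifferentiableAt one_ne_zero
          have hc := HasMFDerivAt.comp t
            (mdifferentiableAt_extChartAt (I := 𝓡 n) hsrc).hasMFDerivAt hγt.hasMFDerivAt
          have heq : extChartAt (𝓡 n) p ∘ γ =ᶠ[𝓝 t] η := by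
            filter_upwards [Icc_mem_nhds ht.1 ht.2] with s hs
            exact (extChartAt (𝓡 n) p).right_inv (hηt s hs)
          have hη' : HasDerivAt η v' t := by
            have := ((hasDerivAt_id t).smul_const v').const_add (extChartAt (𝓡 n) p p)
            rwa [one_smul] at this
          have hc' : HasFDerivAt (extChartAt (𝓡 n) p ∘ γ) (show ℝ →L[ℝ] EuclideanSpace ℝ (Fin n) from
              (chartDiff (n := n) p (γ t)).comp (show ℝ →L[ℝ] TangentSpace (𝓡 n) (γ t) from
                mfderiv 𝓘(ℝ, ℝ) (𝓡 n) γ t)) t := hc.hasFDerivAt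
          have h3 := hc'.congr_of_eventuallyEq heq.symm
          have h4 := h3.unique hη'.hasFDerivAt
          have h5 := congrArg (fun L : ℝ →L[ℝ] EuclideanSpace ℝ (Fin n) => L 1) h4
          simp only [ContinuousLinearMap.toSpanSingleton_apply, one_smul] at h5
          exact h5
      _ = _ := by simp
  have := hlen.trans hle
  rw [← IsRiemannianManifold.out (I := 𝓡 n), edist_dist,
    ENNReal.ofReal_le_ofReal_iff (by positivity)] at this
  exact this

end LocalCoord
end

noncomputable section

section Extension

open Metric Filter Topology Manifold Asymptotics
open scoped ENNReal NNReal

variable {n : ℕ} {M : Type*} [MetricSpace M] [ChartedSpace (EuclideanSpace ℝ (Fin n)) M]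

theorem isLittleO_sub_diffAt_chart {g : M → ℝ} {p : M}
    (hg : MDifferentiableAt (𝓡 n) 𝓘(ℝ, ℝ) g p) :
    (fun x => g x - g p - diffAt g p (localCoord (n := n) p x)) =o[𝓝 p]
      fun x => (show EuclideanSpace ℝ (Fin n) from localCoord (n := n) p x) := by
  have h : HasFDerivWithinAt (writtenInExtChartAt (𝓡 n) 𝓘(ℝ, ℝ) p g)
    (show EuclideanSpace ℝ (Fin n) →L[ℝ] ℝ from diffAt g p) (range (𝓡 n))
    (extChartAt (𝓡 n) p p) := hg.hasMFDerivAt.2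
  rw [modelWithCornersSelf_coe, range_id, hasFDerivWithinAt_univ] at h
  have h2 := h.isLittleO.comp_tendsto (continuousAt_extChartAt (I := 𝓡 n) p)
  refine h2.congr' ?_ (EventuallyEq.refl _ _)
  filter_upwards [chart_source_mem_nhds (EuclideanSpace ℝ (Fin n)) p] with x hx
  have e : ∀ y ∈ (chartAt (EuclideanSpace ℝ (Fin n)) p).source,
      writtenInExtChartAt (𝓡 n) 𝓘(ℝ, ℝ) p g (extChartAt (𝓡 n) p y) = g y := by
    intro y hy
    change g ((extChartAt (𝓡 n) p).symm (extChartAt (𝓡 n) p y)) = g y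
    rw [(extChartAt (𝓡 n) p).left_inv (by rwa [extChartAt_source])]
  rw [Function.comp_apply, e x hx, e p (mem_chart_source _ p)]
  rfl

variable [RiemannianBundle (fun x : M => TangentSpace (𝓡 n) x)]

theorem isLittleO_sub_diffAt_localCoord {g : M → ℝ} {p : M}
    (hg : MDifferentiableAt (𝓡 n) 𝓘(ℝ, ℝ) g p) :
    (fun x => g x - g p - diffAt g p (localCoord (n := n) p x)) =o[𝓝 p]
      fun x => localCoord (n := n) p x := by
  refine (isLittleO_sub_diffAt_chart hg).trans_isBigO ?_
  let L : TangentSpace (𝓡 n) p →L[ℝ] EuclideanSpace ℝ (Fin n) :=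
    ContinuousLinearMap.id ℝ (EuclideanSpace ℝ (Fin n))
  exact L.isBigO_comp (localCoord (n := n) p) (𝓝 p)

variable [IsManifold (𝓡 n) ∞ M]
  [IsContMDiffRiemannianBundle (𝓡 n) ∞ (EuclideanSpace ℝ (Fin n))
      (fun x : M => TangentSpace (𝓡 n) x)]
  [IsRiemannianManifold (𝓡 n) M]

theorem isLittleO_sub_diffAt_dist {g : M → ℝ} {p : M}
    (hg : MDifferentiableAt (𝓡 n) 𝓘(ℝ, ℝ) g p) :
    (fun x => g x - g p - diffAt g p (localCoord (n := n) p x)) =o[𝓝 p] fun x => dist p x := by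
  refine (isLittleO_sub_diffAt_localCoord hg).trans_isBigO ?_
  refine IsBigO.of_bound 2 ?_
  filter_upwards [eventually_norm_localCoord_le (n := n) p one_lt_two] with x hx
  rwa [Real.norm_of_nonneg dist_nonneg]

omit [IsManifold (𝓡 n) ∞ M] [IsContMDiffRiemannianBundle (𝓡 n) ∞ (EuclideanSpace ℝ (Fin n))
  (fun x : M => TangentSpace (𝓡 n) x)] [IsRiemannianManifold (𝓡 n) M] in
theorem isLittleO_localPoint {g : M → ℝ} {p : M}
    (hg : MDifferentiableAt (𝓡 n) 𝓘(ℝ, ℝ) g p) :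
    (fun v => g (localPoint p v) - g p - diffAt g p v) =o[𝓝 0]
      fun v : TangentSpace (𝓡 n) p => v := by
  refine ((isLittleO_sub_diffAt_localCoord hg).comp_tendsto (tendsto_localPoint (n := n) p)).congr'
    ?_ ?_
  · filter_upwards [eventually_localCoord_localPoint (n := n) p] with v hv
    rw [Function.comp_apply, hv]
  · filter_upwards [eventually_localCoord_localPoint (n := n) p] with v hv
    rw [Function.comp_apply, hv]

omit [IsManifold (𝓡 n) ∞ M] [IsContMDiffRiemannianBundle (𝓡 n) ∞ (EuclideanSpace ℝ (Fin n))
  (fun x : M => TangentSpace (𝓡 n) x)] [IsRiemannianManifold (𝓡 n) M]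
  [RiemannianBundle (fun x : M => TangentSpace (𝓡 n) x)] in
theorem mdifferentiableAt_dist {c : ℝ} {p q : M} (hpq : p ≠ q)
    (hsm : MDifferentiableAt (𝓡 n) 𝓘(ℝ, ℝ) (coshFun c p) q) :
    MDifferentiableAt (𝓡 n) 𝓘(ℝ, ℝ) (fun x => dist p x) q := by
  have h1 : DifferentiableAt ℝ (fun y => Real.arcosh (y - c)) (coshFun c p q) := by
    refine (Real.hasDerivAt_arcosh ?_).differentiableAt.comp (f := fun y : ℝ => y - c) _ (by fun_prop)
    simp only [coshFun, add_sub_cancel_right, mem_Ioi]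
    exact Real.one_lt_cosh.2 (dist_pos.2 hpq).ne'
  have h2 := h1.mdifferentiableAt.comp q hsm
  convert h2 using 2 with x
  simp [coshFun, Real.arcosh_cosh dist_nonneg]

variable [ProperSpace M]

theorem frequently_lt_dist {c : ℝ} {p q : M} (hpq : p ≠ q)
    (hsm : MDifferentiableAt (𝓡 n) 𝓘(ℝ, ℝ) (coshFun c p) q) {ε : ℝ} (hε : 0 < ε) (hε1 : ε < 1) :
    ∃ᶠ x in 𝓝 q, dist p q + (1 - ε) * dist q x < dist p x := by
  have hr := mdifferentiableAt_dist hpq hsm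
  set ℓ := diffAt (n := n) (fun x => dist p x) q with hℓ
  obtain ⟨η, hη⟩ : ∃ η, η = ε / 8 := ⟨_, rfl⟩
  have hη0 : 0 < η := by linarith
  have hR : 0 < dist q p := dist_pos.2 hpq.symm
  have hz : ∀ s : ℝ, ∃ z : M, s ∈ Ioo 0 (dist q p) → dist q z = s ∧ dist z p = dist q p - s := by
    intro s
    by_cases hs : s ∈ Ioo 0 (dist q p)
    · obtain ⟨z, h1, h2⟩ := (hasApproxBetween_of_riemannian n M).exists_between q p hs.1.le hs.2.le
      exact ⟨z, fun _ => ⟨h1, h2⟩⟩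
    · exact ⟨q, fun h => absurd h hs⟩
  choose z hz using hz
  have hs0 : ∀ᶠ s in 𝓝[>] (0 : ℝ), s ∈ Ioo 0 (dist q p) := Ioo_mem_nhdsGT hR
  have hztend : Tendsto z (𝓝[>] 0) (𝓝 q) := by
    rw [tendsto_iff_dist_tendsto_zero]
    refine Tendsto.congr' (f₁ := fun s => s) ?_ (tendsto_id.mono_left nhdsWithin_le_nhds)
    filter_upwards [hs0] with s hs
    rw [dist_comm, (hz s hs).1]
  have hvtend : Tendsto (fun s => -localCoord (n := n) q (z s)) (𝓝[>] 0) (𝓝 0) := by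
    simpa using ((tendsto_localCoord (n := n) q).comp hztend).neg
  have hxtend := (tendsto_localPoint (n := n) q).comp hvtend
  refine hxtend.frequently (Eventually.frequently ?_)
  filter_upwards [hs0, hztend.eventually ((isLittleO_sub_diffAt_dist hr).bound hη0),
    hztend.eventually (eventually_norm_localCoord_le (n := n) q (show 1 < 1 + η by linarith)),
    hvtend.eventually ((isLittleO_localPoint hr).bound hη0),
    hvtend.eventually (eventually_dist_localPoint_le (n := n) q (show 1 < 1 + η by linarith))]
    with s hs h1 h2 h3 h4
  obtain ⟨hz1, hz2⟩ := hz s hs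
  rw [← hℓ, Real.norm_eq_abs, hz1, Real.norm_of_nonneg hs.1.le, dist_comm p (z s), hz2,
    abs_le] at h1
  rw [norm_neg] at h3 h4
  rw [← hℓ, map_neg, Real.norm_eq_abs, abs_le] at h3
  rw [hz1] at h2
  simp only [Function.comp_apply]
  rw [dist_comm p q] at h1 h3 ⊢
  set K := ‖localCoord (n := n) q (z s)‖
  set D := dist q (localPoint q (-localCoord (n := n) q (z s)))
  have hs0 := hs.1
  have hD : D ≤ (1 + η) * ((1 + η) * s) := h4.trans (mul_le_mul_of_nonneg_left h2 (by linarith))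
  have hK : η * K ≤ η * ((1 + η) * s) := mul_le_mul_of_nonneg_left h2 hη0.le
  have hD2 : (1 - ε) * D ≤ (1 - ε) * ((1 + η) * ((1 + η) * s)) :=
    mul_le_mul_of_nonneg_left hD (by linarith)
  have hgap : (1 - ε) * ((1 + η) * ((1 + η) * s)) < s - η * s - η * ((1 + η) * s) := by
    have : 0 < s * (1 - η - η * (1 + η) - (1 - 8 * η) * ((1 + η) * (1 + η))) := by
      apply mul_pos hs0
      nlinarith [mul_pos hη0 hη0, mul_pos (mul_pos hη0 hη0) hη0]
    rw [show ε = 8 * η by linarith]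
    nlinarith
  linarith [h1.1, h1.2, h3.1]

theorem exists_dist_eq_add {c : ℝ} {p q : M} (hpq : p ≠ q)
    (hsm : MDifferentiable (𝓡 n) 𝓘(ℝ, ℝ) (coshFun c p)) {δ : ℝ} (hδ : 0 ≤ δ) :
    ∃ x, dist q x = δ ∧ dist p x = dist p q + δ := by
  have step : ∀ ε : ℝ, 0 < ε → ε < 1 → ∃ x, dist q x = δ ∧ dist p q + (1 - ε) * δ ≤ dist p x := by
    intro ε hε hε1
    obtain ⟨x0, hx0, hmax⟩ := (isCompact_closedBall q δ).exists_isMaxOn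
      (f := fun x => dist p x - (1 - ε) * dist q x) ⟨q, mem_closedBall_self hδ⟩ (by fun_prop)
    have hq := hmax (mem_closedBall_self hδ)
    simp only [mem_ofPred_eq, dist_self, mul_zero, sub_zero] at hq
    rw [mem_closedBall'] at hx0
    have hpos := dist_pos.2 hpq
    have hx0p : p ≠ x0 := by
      rintro rfl
      rw [dist_self] at hq
      have : 0 ≤ (1 - ε) * dist q p := mul_nonneg (by linarith) dist_nonneg
      linarith
    have heq : dist q x0 = δ := by
      by_contra hne
      have hlt : dist q x0 < δ := lt_of_le_of_ne hx0 hne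
      have hev : ∀ᶠ x in 𝓝 x0, dist q x < δ :=
        (by fun_prop : Continuous fun x => dist q x).continuousAt.eventually_lt_const hlt
      obtain ⟨x, hx, hxδ⟩ := ((frequently_lt_dist hx0p (hsm x0) hε hε1).and_eventually hev).exists
      have h1 := hmax (show x ∈ closedBall q δ by rw [mem_closedBall']; exact hxδ.le)
      simp only [mem_ofPred_eq] at h1
      have h2 := mul_le_mul_of_nonneg_left (dist_triangle q x0 x) (show 0 ≤ 1 - ε by linarith)
      linarith
    exact ⟨x0, heq, by rw [heq] at hq; linarith⟩
  obtain ⟨x1, hx1, -⟩ := step (1 / 2) (by norm_num) (by norm_num)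
  obtain ⟨x, hx, hmax⟩ := (isCompact_sphere q δ).exists_isMaxOn (f := fun x => dist p x)
    ⟨x1, by rwa [mem_sphere']⟩ (by fun_prop)
  rw [mem_sphere'] at hx
  refine ⟨x, hx, le_antisymm (by linarith [dist_triangle p q x]) ?_⟩
  have hlim : Tendsto (fun ε : ℝ => dist p q + (1 - ε) * δ) (𝓝[>] 0)
      (𝓝 (dist p q + (1 - 0) * δ)) :=
    ((by fun_prop : Continuous fun ε : ℝ => dist p q + (1 - ε) * δ).tendsto 0).mono_left
      nhdsWithin_le_nhds
  rw [sub_zero, one_mul] at hlim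
  refine le_of_tendsto hlim ?_
  filter_upwards [Ioo_mem_nhdsGT (show (0 : ℝ) < 1 by norm_num)] with ε hε
  obtain ⟨y, hy, hy'⟩ := step ε hε.1 hε.2
  exact hy'.trans (hmax (by rwa [mem_sphere']))

variable (n) in
theorem hasThirdPoint_of_mdifferentiable [Nontrivial M] {c : ℝ}
    (hsm : ∀ p : M, MDifferentiable (𝓡 n) 𝓘(ℝ, ℝ) (coshFun c p)) : HasThirdPoint M :=
  (hasApproxBetween_of_riemannian n M).hasThirdPoint
    fun p _ hpq _ hδ => exists_dist_eq_add hpq (hsm p) hδ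

end Extension
end

noncomputable section

section Lines

open Filter Topology

variable {M : Type*} [MetricSpace M] {c : ℝ}

theorem radialSpan_induction {P : radialSpan M c → Prop} (hembed : ∀ p, P (embed c p))
    (hzero : P 0) (hadd : ∀ g h, P g → P h → P (g + h)) (hsmul : ∀ (a : ℝ) g, P g → P (a • g))
    (h : radialSpan M c) : P h := by
  obtain ⟨h, hh⟩ := h
  induction hh using Submodule.span_induction with
  | mem x hx =>
    obtain ⟨q, rfl⟩ := hx
    exact hembed q
  | zero => exact hzero
  | add x y hx hy ihx ihy => exact hadd ⟨x, hx⟩ ⟨y, hy⟩ ihx ihy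
  | smul r x hx ihx => exact hsmul r ⟨x, hx⟩ ihx

theorem formB_embed_right (p : M) (h : radialSpan M c) :
    formB c h (embed c p) = (h : M → ℝ) p := by
  induction h using radialSpan_induction with
  | hembed q => rw [formB_embed]; exact coshFun_symm c p q
  | hzero => simp
  | hadd g h hg hh => simp [hg, hh]
  | hsmul a g hg => simp [hg]

theorem formB_symm (g h : radialSpan M c) : formB c g h = formB c h g := by
  induction g using radialSpan_induction with
  | hembed q => rw [formB_embed, formB_embed_right]
  | hzero => simp
  | hadd g h hg hh => simp [hg, hh]
  | hsmul a g hg => simp [hg]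

theorem coshFun_injective : Function.Injective (coshFun c : M → M → ℝ) := by
  intro p q hpq
  have := congrFun hpq p
  simp only [coshFun, dist_self, Real.cosh_zero, add_left_inj] at this
  by_contra hne
  exact (Real.one_lt_cosh.2 (dist_pos.2 (Ne.symm hne)).ne').ne this

theorem embed_injective : Function.Injective (embed c : M → radialSpan M c) :=
  fun _ _ h => coshFun_injective (congrArg Subtype.val h)

theorem formB_embed_embed (p q : M) : formB c (embed c p) (embed c q) = Real.cosh (dist p q) + c := by
  rw [formB_embed]; exact coshFun_symm c q p

theorem Isometry.isGeodesic {γ : ℝ → M} (hγ : Isometry γ) : IsGeodesic γ :=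
  fun _ => ⟨1, one_pos, fun s _ s' _ => by rw [hγ.dist_eq, Real.dist_eq]⟩

variable (c) in
/-- The even coefficient of the functions `f_{γ(t)}`. -/
def evenCoeff (γ : ℝ → M) : radialSpan M c :=
  (2 * (Real.cosh 1 - 1))⁻¹ • (embed c (γ 1) + embed c (γ (-1)) - (2 : ℝ) • embed c (γ 0))

variable (c) in
/-- The odd coefficient of the functions `f_{γ(t)}`. -/
def oddCoeff (γ : ℝ → M) : radialSpan M c :=
  (2 * Real.sinh 1)⁻¹ • (embed c (γ 1) - embed c (γ (-1)))

theorem one_lt_cosh_one : 1 < Real.cosh 1 := Real.one_lt_cosh.2 one_ne_zero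

theorem sinh_one_pos : 0 < Real.sinh 1 := Real.sinh_pos_iff.2 one_pos

theorem embed_mem_curveSpan (γ : ℝ → M) (t : ℝ) : embed c (γ t) ∈ curveSpan c γ :=
  Submodule.subset_span (mem_range_self t)

theorem evenCoeff_mem (γ : ℝ → M) : evenCoeff c γ ∈ curveSpan c γ :=
  Submodule.smul_mem _ _ (Submodule.sub_mem _ (Submodule.add_mem _ (embed_mem_curveSpan γ _)
    (embed_mem_curveSpan γ _)) (Submodule.smul_mem _ _ (embed_mem_curveSpan γ _)))

theorem oddCoeff_mem (γ : ℝ → M) : oddCoeff c γ ∈ curveSpan c γ :=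
  Submodule.smul_mem _ _ (Submodule.sub_mem _ (embed_mem_curveSpan γ _) (embed_mem_curveSpan γ _))

/-- Along a line `γ`, the functions `f_{γ(t)}` trace a conic section in `V_γ`. -/
theorem embed_line {γ : ℝ → M} (hγ : Isometry γ)
    (hB : ((formB c).restrict (curveSpan c γ)).Nondegenerate) (t : ℝ) :
    embed c (γ t) =
      embed c (γ 0) + (Real.cosh t - 1) • evenCoeff c γ + Real.sinh t • oddCoeff c γ := by
  rw [← sub_eq_zero]
  set D := embed c (γ t) -
    (embed c (γ 0) + (Real.cosh t - 1) • evenCoeff c γ + Real.sinh t • oddCoeff c γ) with hD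
  have hDmem : D ∈ curveSpan c γ :=
    Submodule.sub_mem _ (embed_mem_curveSpan γ t) (Submodule.add_mem _ (Submodule.add_mem _
      (embed_mem_curveSpan γ _) (Submodule.smul_mem _ _ (evenCoeff_mem γ)))
      (Submodule.smul_mem _ _ (oddCoeff_mem γ)))
  have hdist : ∀ s t : ℝ, formB c (embed c (γ s)) (embed c (γ t)) = Real.cosh (s - t) + c := by
    intro s t
    rw [formB_embed_embed, hγ.dist_eq, Real.dist_eq, Real.cosh_abs]
  have hzero : ∀ y ∈ curveSpan c γ, formB c D y = 0 := by
    intro y hy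
    induction hy using Submodule.span_induction with
    | mem y hy =>
      obtain ⟨s, rfl⟩ := hy
      have h1 : Real.cosh 1 - 1 ≠ 0 := by linarith [one_lt_cosh_one]
      have h2 := sinh_one_pos.ne'
      simp only [hD, evenCoeff, oddCoeff, map_sub, map_add, map_smul, LinearMap.sub_apply,
        LinearMap.add_apply, LinearMap.smul_apply, hdist, smul_eq_mul, Real.cosh_sub,
        Real.cosh_neg, Real.sinh_neg, Real.cosh_zero, Real.sinh_zero]
      field_simp
      ring
    | zero => simp
    | add x y _ _ hx hy => rw [map_add, hx, hy, add_zero]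
    | smul a x _ hx => rw [map_smul, hx, smul_zero]
  have := hB.1 ⟨D, hDmem⟩ fun y => hzero y y.2
  exact congrArg Subtype.val this

/-- The nondegeneracy hypothesis on all geodesics. -/
def FormNondegenerate (M : Type*) [MetricSpace M] (c : ℝ) : Prop :=
  ∀ γ : ℝ → M, IsGeodesic γ → ((formB c).restrict (curveSpan c γ)).Nondegenerate

theorem FormNondegenerate.embed_line (h : FormNondegenerate M c) {γ : ℝ → M} (hγ : Isometry γ)
    (t : ℝ) : embed c (γ t) =
      embed c (γ 0) + (Real.cosh t - 1) • evenCoeff c γ + Real.sinh t • oddCoeff c γ :=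
  _root_.embed_line hγ (h γ hγ.isGeodesic) t

theorem FormNondegenerate.coshFun_line (h : FormNondegenerate M c) {γ : ℝ → M} (hγ : Isometry γ)
    (t : ℝ) (q : M) : coshFun c q (γ t) =
      coshFun c q (γ 0) + (Real.cosh t - 1) * (evenCoeff c γ : M → ℝ) q +
        Real.sinh t * (oddCoeff c γ : M → ℝ) q := by
  rw [coshFun_symm c q, coshFun_symm c q]
  exact congrFun (congrArg Subtype.val (h.embed_line hγ t)) q

theorem isometry_comp_add {γ : ℝ → M} (hγ : Isometry γ) (u : ℝ) : Isometry fun t => γ (u + t) :=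
  hγ.comp (isometry_add_left u)

theorem FormNondegenerate.line_eq (h : FormNondegenerate M c) {γ γ' : ℝ → M} (hγ : Isometry γ)
    (hγ' : Isometry γ') {u : ℝ} (hu : γ =ᶠ[𝓝 u] γ') : γ = γ' := by
  obtain ⟨δ, hδ, hball⟩ := Metric.eventually_nhds_iff_ball.1 hu
  have e : ∀ t, |t| < δ → γ (u + t) = γ' (u + t) := fun t ht =>
    hball _ (by simpa [Metric.mem_ball, Real.dist_eq] using ht)
  have hpos : 0 < δ / 2 := by linarith
  have e0 := e 0 (by simpa using hδ)
  have e1 := e (δ / 2) (by rw [abs_of_pos hpos]; linarith)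
  have e2 := e (-(δ / 2)) (by rw [abs_neg, abs_of_pos hpos]; linarith)
  have key : ∀ t, embed c (γ (u + t)) = embed c (γ' (u + t)) := by
    have f := h.embed_line (isometry_comp_add hγ u)
    have f' := h.embed_line (isometry_comp_add hγ' u)
    set E := evenCoeff c fun t => γ (u + t)
    set O := oddCoeff c fun t => γ (u + t)
    set E' := evenCoeff c fun t => γ' (u + t)
    set O' := oddCoeff c fun t => γ' (u + t)
    have g1 := f (δ / 2)
    have g2 := f (-(δ / 2))
    have g1' := f' (δ / 2)
    have g2' := f' (-(δ / 2))
    rw [e0] at g1 g2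
    rw [e1, g1'] at g1
    rw [e2, g2'] at g2
    simp only [Real.cosh_neg, Real.sinh_neg] at g1 g2
    have hE : (2 * (Real.cosh (δ / 2) - 1)) • (E' - E) = 0 := by
      linear_combination (norm := module) g1 + g2
    have hO : (2 * Real.sinh (δ / 2)) • (O' - O) = 0 := by
      linear_combination (norm := module) g1 - g2
    have hE' : E' = E := by
      rcases smul_eq_zero.1 hE with h0 | h0
      · have := Real.one_lt_cosh.2 hpos.ne'
        linarith
      · exact sub_eq_zero.1 h0
    have hO' : O' = O := by
      rcases smul_eq_zero.1 hO with h0 | h0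
      · have := Real.sinh_pos_iff.2 hpos
        linarith
      · exact sub_eq_zero.1 h0
    intro t
    rw [f t, f' t, hE', hO', e0]
  funext s
  have := key (s - u)
  rw [add_sub_cancel] at this
  exact embed_injective this

/-- Geodesics are globally distance-realizing. -/
theorem FormNondegenerate.isometry_of_isGeodesic [ProperSpace M] (h : FormNondegenerate M c)
    (h3 : HasThirdPoint M) {γ : ℝ → M} (hγ : IsGeodesic γ) : Isometry γ := by
  have : Nonempty M := ⟨γ 0⟩
  have hloc : ∀ t : ℝ, ∃ γ' : ℝ → M, Isometry γ' ∧ γ =ᶠ[𝓝 t] γ' := by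
    intro t
    obtain ⟨ε, hε, hd⟩ := hγ t
    have hG : IsLinearGraph ((fun s => (s, γ s)) '' Ioo (t - ε) (t + ε)) := by
      rintro _ ⟨s, hs, rfl⟩ _ ⟨s', hs', rfl⟩
      exact hd s hs s' hs'
    obtain ⟨γ', hγ', heq⟩ := hG.exists_isometry h3
    refine ⟨γ', hγ', ?_⟩
    filter_upwards [Ioo_mem_nhds (show t - ε < t by linarith) (show t < t + ε by linarith)] with s hs
    exact (heq _ (mem_image_of_mem _ hs)).symm
  choose ℓ hℓ hℓe using hloc
  have hconst : ∀ t, ℓ t = ℓ 0 := by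
    have hlc : IsLocallyConstant ℓ := by
      rw [IsLocallyConstant.iff_eventually_eq]
      intro t
      filter_upwards [(hℓe t).eventually_nhds] with s hs
      exact h.line_eq (u := s) (hℓ s) (hℓ t) ((hℓe s).symm.trans hs)
    exact fun t => hlc.apply_eq_of_preconnectedSpace t 0
  have : γ = ℓ 0 := by
    funext t
    rw [← hconst t]
    exact (hℓe t).eq_of_nhds
  rw [this]
  exact hℓ 0

/-- Any two points lie on a line. -/
theorem HasThirdPoint.exists_line [ProperSpace M] (h3 : HasThirdPoint M) (p q : M) :
    ∃ γ : ℝ → M, Isometry γ ∧ γ 0 = p ∧ γ (dist p q) = q := by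
  have : Nonempty M := ⟨p⟩
  have hG : IsLinearGraph ({((0 : ℝ), p), (dist p q, q)} : Set (ℝ × M)) := by
    rintro z (rfl | rfl) w (rfl | rfl) <;> simp [dist_comm]
  obtain ⟨γ, hγ, heq⟩ := hG.exists_isometry h3
  exact ⟨γ, hγ, heq (0, p) (by simp), heq (dist p q, q) (by simp)⟩

end Lines
end

noncomputable section

section Velocity

open Metric Filter Topology Manifold Asymptotics
open scoped ENNReal NNReal

variable {n : ℕ} {M : Type*} [MetricSpace M] [ChartedSpace (EuclideanSpace ℝ (Fin n)) M]

instance finiteDimensional_tangentSpace (p : M) : FiniteDimensional ℝ (TangentSpace (𝓡 n) p) :=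
  inferInstanceAs (FiniteDimensional ℝ (EuclideanSpace ℝ (Fin n)))

theorem tendsto_slope_of_isLittleO {g : M → ℝ} {p : M} {γ : ℝ → M} {l : Filter ℝ}
    (hg : (fun x => g x - g p - diffAt g p (localCoord (n := n) p x)) =o[𝓝 p] fun x => dist p x)
    (hγ : Tendsto γ l (𝓝 p)) (hd : (fun s => dist p (γ s)) =O[l] fun s => s) :
    Tendsto (fun s => (g (γ s) - g p) / s - diffAt g p (s⁻¹ • localCoord (n := n) p (γ s))) l
      (𝓝 0) := by
  have h1 := ((hg.comp_tendsto hγ).trans_isBigO hd).tendsto_div_nhds_zero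
  refine h1.congr fun s => ?_
  simp only [Function.comp_apply, map_smul, smul_eq_mul]
  ring

theorem tendsto_smul_right_zero (p : M) (w : TangentSpace (𝓡 n) p) :
    Tendsto (fun s : ℝ => s • w) (𝓝 0) (𝓝 0) := by
  have : ContinuousAt (fun s : ℝ => s • w) 0 := by fun_prop
  simpa [ContinuousAt] using this

variable [RiemannianBundle (fun x : M => TangentSpace (𝓡 n) x)]

/-- In the preferred chart at `p`, the curve `γ` has velocity `u` at time `0`. -/
def HasLocalVelocity (γ : ℝ → M) (p : M) (u : TangentSpace (𝓡 n) p) : Prop :=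
  Tendsto (fun s : ℝ => s⁻¹ • localCoord (n := n) p (γ s)) (𝓝[≠] 0) (𝓝 u)

theorem hasDerivAt_localPoint {g : M → ℝ} {p : M} (hg : MDifferentiableAt (𝓡 n) 𝓘(ℝ, ℝ) g p)
    (w : TangentSpace (𝓡 n) p) :
    HasDerivAt (fun s : ℝ => g (localPoint p (s • w))) (diffAt g p w) 0 := by
  rw [hasDerivAt_iff_isLittleO]
  have hO : ((fun v => v) ∘ fun s : ℝ => s • w) =O[𝓝 0] fun s : ℝ => s :=
    IsBigO.of_bound ‖w‖ (Eventually.of_forall fun s => by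
      rw [Function.comp_apply, norm_smul, mul_comm])
  have := ((isLittleO_localPoint hg).comp_tendsto (tendsto_smul_right_zero p w)).trans_isBigO hO
  refine this.congr (fun s => ?_) (fun s => by rw [sub_zero])
  simp only [Function.comp_apply, map_smul, zero_smul, localPoint_zero, sub_zero, smul_eq_mul]

variable [IsManifold (𝓡 n) ∞ M]
  [IsContMDiffRiemannianBundle (𝓡 n) ∞ (EuclideanSpace ℝ (Fin n))
      (fun x : M => TangentSpace (𝓡 n) x)]
  [IsRiemannianManifold (𝓡 n) M]

theorem HasLocalVelocity.hasDerivAt {γ : ℝ → M} {p : M} {u : TangentSpace (𝓡 n) p}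
    (hu : HasLocalVelocity γ p u) (hγ : Isometry γ) (h0 : γ 0 = p) {g : M → ℝ}
    (hg : MDifferentiableAt (𝓡 n) 𝓘(ℝ, ℝ) g p) : HasDerivAt (g ∘ γ) (diffAt g p u) 0 := by
  rw [hasDerivAt_iff_tendsto_slope]
  have hγ0 : Tendsto γ (𝓝[≠] 0) (𝓝 p) := by
    rw [← h0]; exact hγ.continuous.continuousAt.tendsto.mono_left nhdsWithin_le_nhds
  have h1 := tendsto_slope_of_isLittleO (isLittleO_sub_diffAt_dist hg) hγ0
    (IsBigO.of_bound 1 (Eventually.of_forall fun s => by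
      rw [← h0, hγ.dist_eq, Real.norm_eq_abs, abs_of_nonneg dist_nonneg, one_mul, dist_comm,
        Real.dist_eq, sub_zero, Real.norm_eq_abs]))
  have h2 := h1.add (((diffAt (n := n) g p).continuous.tendsto u).comp hu)
  rw [zero_add] at h2
  refine h2.congr fun s => ?_
  simp [slope_def_field, h0]

theorem diffAt_coshFun_le {c : ℝ} {p q : M}
    (hsm : MDifferentiableAt (𝓡 n) 𝓘(ℝ, ℝ) (coshFun c q) p) (w : TangentSpace (𝓡 n) p) :
    diffAt (coshFun c q) p w ≤ Real.sinh (dist p q) * ‖w‖ := by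
  have key : ∀ r : ℝ, 1 < r → diffAt (coshFun c q) p w ≤ Real.sinh (dist p q) * (r * ‖w‖) := by
    intro r hr
    have h1 := (hasDerivAt_localPoint hsm w).tendsto_slope_zero_right
    have h2 : HasDerivAt (fun s : ℝ => Real.cosh (dist p q + s * (r * ‖w‖)) + c)
        (Real.sinh (dist p q) * (r * ‖w‖)) 0 := by
      have h3 : HasDerivAt (fun s : ℝ => dist p q + s * (r * ‖w‖)) (r * ‖w‖) 0 := by
        simpa using ((hasDerivAt_id (0 : ℝ)).mul_const (r * ‖w‖)).const_add (dist p q)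
      have := h3.cosh.add_const c
      simpa using this
    refine le_of_tendsto_of_tendsto h1 h2.tendsto_slope_zero_right ?_
    have hev : ∀ᶠ s : ℝ in 𝓝[>] 0, dist p (localPoint p (s • w)) ≤ r * ‖s • w‖ :=
      ((tendsto_smul_right_zero p w).mono_left nhdsWithin_le_nhds).eventually
        (eventually_dist_localPoint_le p hr)
    filter_upwards [hev, self_mem_nhdsWithin] with s hs hs0
    rw [mem_Ioi] at hs0
    rw [norm_smul, Real.norm_of_nonneg hs0.le] at hs
    refine smul_le_smul_of_nonneg_left ?_ (by positivity)
    simp only [zero_add, zero_smul, localPoint_zero, zero_mul, add_zero]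
    have h5 : dist q (localPoint p (s • w)) ≤ dist p q + s * (r * ‖w‖) := by
      have := dist_triangle q p (localPoint p (s • w))
      rw [dist_comm q p] at this
      linarith
    have h6 : Real.cosh (dist q (localPoint p (s • w))) ≤ Real.cosh (dist p q + s * (r * ‖w‖)) := by
      rw [Real.cosh_le_cosh, abs_of_nonneg dist_nonneg, abs_of_nonneg (dist_nonneg.trans h5)]
      exact h5
    simp only [coshFun]
    rw [dist_comm q p]
    linarith
  have hlim : Tendsto (fun r : ℝ => Real.sinh (dist p q) * (r * ‖w‖)) (𝓝[>] 1)
      (𝓝 (Real.sinh (dist p q) * (1 * ‖w‖))) :=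
    ((by fun_prop : Continuous fun r : ℝ => Real.sinh (dist p q) * (r * ‖w‖)).tendsto 1).mono_left
      nhdsWithin_le_nhds
  rw [one_mul] at hlim
  exact ge_of_tendsto hlim (eventually_nhdsWithin_of_forall fun r hr => key r hr)

theorem diffAt_coshFun_self {c : ℝ} {p : M}
    (hsm : MDifferentiableAt (𝓡 n) 𝓘(ℝ, ℝ) (coshFun c p) p) (w : TangentSpace (𝓡 n) p) :
    diffAt (coshFun c p) p w = 0 := by
  have h1 := diffAt_coshFun_le hsm w
  have h2 := diffAt_coshFun_le hsm (-w)
  rw [map_neg] at h2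
  simp only [dist_self, Real.sinh_zero, zero_mul] at h1 h2
  linarith

theorem exists_localVelocity_of_pos {c : ℝ} {γ : ℝ → M} (hγ : Isometry γ) {p : M} (h0 : γ 0 = p)
    {t : ℝ} (ht : 0 < t) (hsm : MDifferentiableAt (𝓡 n) 𝓘(ℝ, ℝ) (coshFun c (γ t)) p) :
    ∃ u : TangentSpace (𝓡 n) p, ‖u‖ = 1 ∧ HasLocalVelocity γ p u ∧
      ∀ w, diffAt (coshFun c (γ t)) p w = -Real.sinh t * inner ℝ u w := by
  have := FiniteDimensional.complete ℝ (TangentSpace (𝓡 n) p)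
  set ℓ := diffAt (n := n) (coshFun c (γ t)) p with hℓ
  have hsinh : 0 < Real.sinh t := Real.sinh_pos_iff.2 ht
  set g : TangentSpace (𝓡 n) p := -(Real.sinh t)⁻¹ • (InnerProductSpace.toDual ℝ _).symm ℓ with hg
  have hℓg : ∀ w, ℓ w = -Real.sinh t * inner ℝ g w := by
    intro w
    rw [hg, inner_smul_left, InnerProductSpace.toDual_symm_apply]
    simp only [conj_trivial]
    field_simp
  have hdist : dist p (γ t) = t := by
    rw [← h0, hγ.dist_eq, dist_comm, Real.dist_eq, sub_zero, abs_of_pos ht]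
  have hg1 : ‖g‖ ≤ 1 := by
    have h1 := diffAt_coshFun_le hsm (-g)
    rw [map_neg, ← hℓ, hℓg, real_inner_self_eq_norm_mul_norm, norm_neg, hdist] at h1
    have h2 : ‖g‖ * ‖g‖ ≤ ‖g‖ := by
      refine le_of_mul_le_mul_left ?_ hsinh
      linarith
    by_contra hlt
    nlinarith
  have hγ0 : Tendsto γ (𝓝[≠] 0) (𝓝 p) := by
    rw [← h0]; exact hγ.continuous.continuousAt.tendsto.mono_left nhdsWithin_le_nhds
  have hds : ∀ s, dist p (γ s) = |s| := fun s => by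
    rw [← h0, hγ.dist_eq, dist_comm, Real.dist_eq, sub_zero]
  have hinner : Tendsto (fun s : ℝ => inner ℝ g (s⁻¹ • localCoord (n := n) p (γ s))) (𝓝[≠] 0)
      (𝓝 1) := by
    have h1 := tendsto_slope_of_isLittleO (isLittleO_sub_diffAt_dist hsm) hγ0
      (IsBigO.of_bound 1 (Eventually.of_forall fun s => by
        rw [hds, Real.norm_eq_abs, abs_abs, one_mul, Real.norm_eq_abs]))
    have h2 : HasDerivAt (fun s : ℝ => Real.cosh (t - s) + c) (-Real.sinh t) 0 := by
      have h3 : HasDerivAt (fun s : ℝ => t - s) (-1) 0 := by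
        simpa using (hasDerivAt_id (0 : ℝ)).const_sub t
      have := h3.cosh.add_const c
      simpa using this
    have h4 := (hasDerivAt_iff_tendsto_slope.1 h2).sub h1
    rw [sub_zero] at h4
    have h5 := h4.const_mul (-(Real.sinh t)⁻¹)
    rw [neg_mul_neg, inv_mul_cancel₀ hsinh.ne'] at h5
    refine h5.congr fun s => ?_
    have e1 : coshFun c (γ t) (γ s) = Real.cosh (t - s) + c := by
      rw [coshFun, hγ.dist_eq, Real.dist_eq, Real.cosh_abs]
    have e2 : coshFun c (γ t) p = Real.cosh t + c := by
      rw [coshFun, dist_comm, hdist]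
    rw [← hℓ, hℓg, slope_def_field, e1, e2, sub_zero, sub_zero]
    field_simp
    ring
  have htend : HasLocalVelocity γ p g := by
    rw [HasLocalVelocity, tendsto_iff_norm_sub_tendsto_zero]
    rw [Metric.tendsto_nhds]
    intro ε hε
    obtain ⟨η, hη0, hη1, hηε⟩ : ∃ η : ℝ, 0 < η ∧ η ≤ 1 ∧ 6 * η ≤ ε ^ 2 :=
      ⟨min 1 (ε ^ 2 / 6), by positivity, min_le_left _ _, by
        have := min_le_right 1 (ε ^ 2 / 6); linarith⟩
    filter_upwards [hinner.eventually (eventually_gt_nhds (show 1 - η < 1 by linarith)),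
      hγ0.eventually (eventually_norm_localCoord_le (n := n) p (show 1 < 1 + η by linarith)),
      self_mem_nhdsWithin] with s hs1 hs2 hs0
    have hs0' : 0 < |s| := abs_pos.2 hs0
    rw [hds] at hs2
    have hw : ‖s⁻¹ • localCoord (n := n) p (γ s)‖ ≤ 1 + η := by
      rw [norm_smul, norm_inv, Real.norm_eq_abs, inv_mul_le_iff₀ hs0', mul_comm]
      exact hs2
    set w := s⁻¹ • localCoord (n := n) p (γ s)
    rw [dist_zero_right, norm_norm]
    have hsq : ‖w - g‖ ^ 2 < ε ^ 2 := by
      rw [norm_sub_sq_real, real_inner_comm]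
      have a1 : ‖w‖ ^ 2 ≤ (1 + η) ^ 2 := pow_le_pow_left₀ (norm_nonneg _) hw 2
      have a2 : ‖g‖ ^ 2 ≤ 1 := pow_le_one₀ (norm_nonneg _) hg1
      nlinarith
    exact lt_of_pow_lt_pow_left₀ 2 hε.le hsq
  refine ⟨g, ?_, htend, hℓg⟩
  have h1 : Tendsto (fun s : ℝ => inner ℝ g (s⁻¹ • localCoord (n := n) p (γ s))) (𝓝[≠] 0)
      (𝓝 (inner ℝ g g)) := tendsto_const_nhds.inner htend
  have h2 := tendsto_nhds_unique h1 hinner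
  rw [real_inner_self_eq_norm_mul_norm] at h2
  nlinarith [norm_nonneg g]

theorem exists_localVelocity {c : ℝ} (hsm : ∀ q : M, MDifferentiable (𝓡 n) 𝓘(ℝ, ℝ) (coshFun c q))
    {γ : ℝ → M} (hγ : Isometry γ) {p : M} (h0 : γ 0 = p) :
    ∃ u : TangentSpace (𝓡 n) p, ‖u‖ = 1 ∧ HasLocalVelocity γ p u ∧
      ∀ t w, diffAt (coshFun c (γ t)) p w = -Real.sinh t * inner ℝ u w := by
  obtain ⟨u, hu1, hu, -⟩ := exists_localVelocity_of_pos hγ h0 one_pos (hsm (γ 1) p)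
  refine ⟨u, hu1, hu, fun t w => ?_⟩
  rcases lt_trichotomy t 0 with ht | rfl | ht
  · have hγ' : Isometry fun s => γ (-s) := hγ.comp (IsometryEquiv.neg ℝ).isometry
    obtain ⟨v, -, hv, hv'⟩ := exists_localVelocity_of_pos (c := c) hγ' (p := p)
      (by simpa using h0) (neg_pos.2 ht) (hsm _ p)
    have hneg : Tendsto (fun s : ℝ => -s) (𝓝[≠] 0) (𝓝[≠] 0) := by
      refine tendsto_nhdsWithin_iff.2 ⟨?_, ?_⟩
      · have : ContinuousAt (fun s : ℝ => -s) 0 := by fun_prop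
        simpa [ContinuousAt] using this.tendsto.mono_left nhdsWithin_le_nhds
      · filter_upwards [self_mem_nhdsWithin] with s hs
        simpa using hs
    have h1 := (hu.comp hneg).neg
    have hvu : v = -u := by
      refine tendsto_nhds_unique hv (h1.congr fun s => ?_)
      simp [inv_neg]
    have := hv' w
    rw [neg_neg] at this
    rw [this, hvu, inner_neg_left, Real.sinh_neg]
    ring
  · rw [h0, diffAt_coshFun_self (hsm p p)]
    simp
  · obtain ⟨v, -, hv, hv'⟩ := exists_localVelocity_of_pos hγ h0 ht (hsm (γ t) p)
    rw [hv' w, tendsto_nhds_unique hv hu]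

end Velocity
end

noncomputable section

section Surjective

open Metric Filter Topology Manifold Asymptotics
open scoped ENNReal NNReal

variable {n : ℕ} {M : Type*} [MetricSpace M] [ChartedSpace (EuclideanSpace ℝ (Fin n)) M]
  [RiemannianBundle (fun x : M => TangentSpace (𝓡 n) x)] [IsManifold (𝓡 n) ∞ M]
  [IsContMDiffRiemannianBundle (𝓡 n) ∞ (EuclideanSpace ℝ (Fin n))
      (fun x : M => TangentSpace (𝓡 n) x)]
  [IsRiemannianManifold (𝓡 n) M]

theorem oddCoeff_eq_diffAt {c : ℝ} (hsm : ∀ q : M, MDifferentiable (𝓡 n) 𝓘(ℝ, ℝ) (coshFun c q))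
    (hB : FormNondegenerate M c) {γ : ℝ → M} (hγ : Isometry γ) {p : M} (h0 : γ 0 = p)
    {u : TangentSpace (𝓡 n) p} (hu : HasLocalVelocity γ p u) (q : M) :
    (oddCoeff c γ : M → ℝ) q = diffAt (coshFun c q) p u := by
  have h1 := hu.hasDerivAt hγ h0 (hsm q p)
  have h2 : HasDerivAt (coshFun c q ∘ γ) ((oddCoeff c γ : M → ℝ) q) 0 := by
    have e : coshFun c q ∘ γ = fun t => coshFun c q (γ 0) +
        (Real.cosh t - 1) * (evenCoeff c γ : M → ℝ) q +
        Real.sinh t * (oddCoeff c γ : M → ℝ) q := funext fun t => hB.coshFun_line hγ t q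
    rw [e]
    have h : HasDerivAt (fun t => coshFun c q (γ 0) +
        (Real.cosh t - 1) * (evenCoeff c γ : M → ℝ) q + Real.sinh t * (oddCoeff c γ : M → ℝ) q)
        (Real.sinh 0 * (evenCoeff c γ : M → ℝ) q + Real.cosh 0 * (oddCoeff c γ : M → ℝ) q) 0 :=
      ((((Real.hasDerivAt_cosh 0).sub_const 1).mul_const
      ((evenCoeff c γ : M → ℝ) q)).const_add (coshFun c q (γ 0))).add
      ((Real.hasDerivAt_sinh 0).mul_const ((oddCoeff c γ : M → ℝ) q))
    simpa using h
  exact h2.unique h1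

theorem oddCoeff_apply (c : ℝ) (γ : ℝ → M) (q : M) : (oddCoeff c γ : M → ℝ) q =
    (2 * Real.sinh 1)⁻¹ * (coshFun c q (γ 1) - coshFun c q (γ (-1))) := by
  rw [coshFun_symm c q, coshFun_symm c q]
  rfl

theorem evenCoeff_apply (c : ℝ) (γ : ℝ → M) (q : M) : (evenCoeff c γ : M → ℝ) q =
    (2 * (Real.cosh 1 - 1))⁻¹ *
      (coshFun c q (γ 1) + coshFun c q (γ (-1)) - 2 * coshFun c q (γ 0)) := by
  rw [coshFun_symm c q, coshFun_symm c q, coshFun_symm c q]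
  rfl

theorem tendsto_dist_localPoint_div {p : M} {u : TangentSpace (𝓡 n) p} (hu : ‖u‖ = 1) :
    Tendsto (fun s : ℝ => dist p (localPoint p (s • u)) / s) (𝓝[>] 0) (𝓝 1) := by
  have hu0 : Tendsto (fun s : ℝ => s • u) (𝓝[>] 0) (𝓝 0) :=
    (tendsto_smul_right_zero p u).mono_left nhdsWithin_le_nhds
  have hx := (tendsto_localPoint (n := n) p).comp hu0
  have key : ∀ r : ℝ, 1 < r → ∀ᶠ s : ℝ in 𝓝[>] 0,
      r⁻¹ ≤ dist p (localPoint p (s • u)) / s ∧ dist p (localPoint p (s • u)) / s ≤ r := by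
    intro r hr
    filter_upwards [hu0.eventually (eventually_dist_localPoint_le p hr),
      hu0.eventually (eventually_localCoord_localPoint p),
      hx.eventually (eventually_norm_localCoord_le (n := n) p hr), self_mem_nhdsWithin]
      with s h1 h2 h3 hs
    rw [mem_Ioi] at hs
    have hr0 : 0 < r := by linarith
    simp only [Function.comp_apply] at h3
    rw [h2] at h3
    rw [norm_smul, hu, mul_one, Real.norm_of_nonneg hs.le] at h1 h3
    refine ⟨?_, ?_⟩
    · rw [le_div_iff₀ hs, inv_mul_le_iff₀ hr0]; exact h3
    · rw [div_le_iff₀ hs]; exact h1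
  rw [tendsto_order]
  refine ⟨fun a ha => ?_, fun a ha => ?_⟩
  · rcases le_or_gt a 0 with h0 | h0
    · filter_upwards [key 2 one_lt_two] with s hs
      exact (h0.trans_lt (by norm_num)).trans_le hs.1
    · obtain ⟨b, hab, hb⟩ := exists_between ha
      have hb0 : 0 < b := h0.trans hab
      filter_upwards [key b⁻¹ ((one_lt_inv₀ hb0).2 hb)] with s hs
      rw [inv_inv] at hs
      exact hab.trans_le hs.1
  · obtain ⟨b, hb, hab⟩ := exists_between ha
    filter_upwards [key b hb] with s hs
    exact hs.2.trans_lt hab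

variable [ProperSpace M]

/-- Every unit vector is the velocity of a line. -/
theorem exists_line_of_norm_eq_one {c : ℝ}
    (hsm : ∀ q : M, MDifferentiable (𝓡 n) 𝓘(ℝ, ℝ) (coshFun c q))
    (hB : FormNondegenerate M c) (h3 : HasThirdPoint M) {p : M} {u : TangentSpace (𝓡 n) p}
    (hu : ‖u‖ = 1) : ∃ γ : ℝ → M, Isometry γ ∧ γ 0 = p ∧ HasLocalVelocity γ p u := by
  have : Nonempty M := ⟨p⟩
  choose γ hγ hγ0 hγd using fun s : ℝ => h3.exists_line p (localPoint p (s • u))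
  have hdiv := tendsto_dist_localPoint_div hu
  set d : ℝ → ℝ := fun s => dist p (localPoint p (s • u)) with hd
  have hd0 : Tendsto d (𝓝[>] 0) (𝓝 0) := by
    have h1 : Tendsto (fun s : ℝ => localPoint p (s • u)) (𝓝[>] 0) (𝓝 p) :=
      (tendsto_localPoint (n := n) p).comp
        ((tendsto_smul_right_zero p u).mono_left nhdsWithin_le_nhds)
    simpa using (tendsto_const_nhds (x := p)).dist h1
  have hmem : ∀ s t, γ s t ∈ closedBall p |t| := by
    intro s t
    rw [mem_closedBall', ← hγ0 s, (hγ s).dist_eq, dist_comm, Real.dist_eq, sub_zero]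
  have hcont : ∀ q, Continuous (coshFun c q) := fun q => (hsm q).continuous
  have hslope : ∀ {F : ℝ → ℝ} {F' : ℝ}, HasDerivAt F F' 0 → F 0 = 0 →
      Tendsto (fun s => F (d s) / s) (𝓝[>] 0) (𝓝 F') := by
    intro F F' hF hF0
    have h1 : (fun x => F x - F' * x) =o[𝓝 0] fun x => x := by
      have := hasDerivAt_iff_isLittleO.1 hF
      simpa [hF0, mul_comm] using this
    have h2 : d =O[𝓝[>] 0] fun s => s := by
      refine isBigO_of_div_tendsto_nhds ?_ 1 hdiv
      filter_upwards [self_mem_nhdsWithin] with s hs hs0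
      exact absurd hs0 (ne_of_gt hs)
    have h4 := ((h1.comp_tendsto hd0).trans_isBigO h2).tendsto_div_nhds_zero.add
      (hdiv.const_mul F')
    rw [zero_add, mul_one] at h4
    refine h4.congr fun s => ?_
    simp only [Function.comp_apply]
    ring
  have hodd : ∀ q, Tendsto (fun s => (oddCoeff c (γ s) : M → ℝ) q) (𝓝[>] 0)
      (𝓝 (diffAt (coshFun c q) p u)) := by
    intro q
    obtain ⟨C, hC⟩ := (isCompact_closedBall p 1).exists_bound_of_continuousOn
      (hcont q).continuousOn
    have hbd : ∀ s, ‖(evenCoeff c (γ s) : M → ℝ) q‖ ≤ (2 * (Real.cosh 1 - 1))⁻¹ * (4 * C) := by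
      intro s
      have hpos : 0 ≤ (2 * (Real.cosh 1 - 1))⁻¹ := by
        have := one_lt_cosh_one
        exact inv_nonneg.2 (by linarith)
      rw [evenCoeff_apply, norm_mul, Real.norm_of_nonneg hpos]
      refine mul_le_mul_of_nonneg_left ?_ hpos
      have b1 := hC _ (by simpa using hmem s 1)
      have b2 := hC _ (by simpa using hmem s (-1))
      have b3 := hC (γ s 0) (by rw [hγ0]; exact mem_closedBall_self zero_le_one)
      rw [Real.norm_eq_abs, abs_le] at *
      constructor <;> linarith [b1.1, b1.2, b2.1, b2.2, b3.1, b3.2]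
    have hcosh : Tendsto (fun s => (Real.cosh (d s) - 1) / s) (𝓝[>] 0) (𝓝 0) := by
      refine hslope (F := fun x => Real.cosh x - 1) ?_ (by simp)
      simpa using (Real.hasDerivAt_cosh 0).sub_const 1
    have hsinh : Tendsto (fun s => Real.sinh (d s) / s) (𝓝[>] 0) (𝓝 1) := by
      refine hslope (F := Real.sinh) ?_ Real.sinh_zero
      simpa using Real.hasDerivAt_sinh 0
    have heven : Tendsto (fun s => (Real.cosh (d s) - 1) / s * (evenCoeff c (γ s) : M → ℝ) q)
        (𝓝[>] 0) (𝓝 0) :=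
      hcosh.zero_mul_isBoundedUnder_le
        (isBoundedUnder_of ⟨_, hbd⟩)
    have hf := (hasDerivAt_localPoint (hsm q p) u).tendsto_slope_zero_right
    have h5 := (hf.sub heven).div hsinh one_ne_zero
    rw [sub_zero, div_one] at h5
    refine h5.congr' ?_
    filter_upwards [self_mem_nhdsWithin, hdiv.eventually (eventually_gt_nhds zero_lt_one)]
      with s hs hs2
    rw [mem_Ioi] at hs
    have hds : 0 < d s := (div_pos_iff_of_pos_right hs).1 hs2
    have hsd : Real.sinh (d s) ≠ 0 := (Real.sinh_pos_iff.2 hds).ne'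
    have e1 := hB.coshFun_line (hγ s) (d s) q
    rw [hγd, hγ0] at e1
    simp only [zero_add, zero_smul, localPoint_zero, smul_eq_mul, Pi.div_apply]
    rw [e1]
    field_simp
    ring
  obtain ⟨s, hs⟩ : ∃ s : ℕ → ℝ, Tendsto s atTop (𝓝[>] 0) := exists_seq_tendsto _
  obtain ⟨⟨y, y'⟩, -, φ, hφ, hlim⟩ :=
    ((isCompact_closedBall p 1).prod (isCompact_closedBall p 1)).tendsto_subseq
      (x := fun k => (γ (s k) 1, γ (s k) (-1)))
      fun k => ⟨by simpa using hmem (s k) 1, by simpa using hmem (s k) (-1)⟩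
  rw [nhds_prod_eq] at hlim
  have hy : Tendsto (fun k => γ (s (φ k)) 1) atTop (𝓝 y) := tendsto_fst.comp hlim
  have hy' : Tendsto (fun k => γ (s (φ k)) (-1)) atTop (𝓝 y') := tendsto_snd.comp hlim
  have hodd' : ∀ q, (2 * Real.sinh 1)⁻¹ * (coshFun c q y - coshFun c q y') =
      diffAt (coshFun c q) p u := by
    intro q
    refine tendsto_nhds_unique ?_ ((hodd q).comp (hs.comp hφ.tendsto_atTop))
    have := ((((hcont q).tendsto y).comp hy).sub (((hcont q).tendsto y').comp hy')).const_mul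
      (2 * Real.sinh 1)⁻¹
    refine this.congr fun k => ?_
    simp only [Function.comp_apply]
    rw [oddCoeff_apply]
  have hdpy : dist p y = 1 := by
    refine tendsto_nhds_unique ((tendsto_const_nhds (x := p)).dist hy)
      (tendsto_const_nhds.congr fun k => ?_)
    rw [← hγ0 (s (φ k)), (hγ _).dist_eq, Real.dist_eq]; norm_num
  have hdpy' : dist p y' = 1 := by
    refine tendsto_nhds_unique ((tendsto_const_nhds (x := p)).dist hy')
      (tendsto_const_nhds.congr fun k => ?_)
    rw [← hγ0 (s (φ k)), (hγ _).dist_eq, Real.dist_eq]; norm_num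
  have hdyy' : dist y y' = 2 := by
    refine tendsto_nhds_unique (hy.dist hy') (tendsto_const_nhds.congr fun k => ?_)
    rw [(hγ _).dist_eq, Real.dist_eq]; norm_num
  have hG : IsLinearGraph ({((0 : ℝ), p), (1, y), (-1, y')} : Set (ℝ × M)) := by
    rintro z (rfl | rfl | rfl) w (rfl | rfl | rfl) <;>
      simp only [dist_self, hdpy, hdpy', hdyy', dist_comm y p, dist_comm y' p, dist_comm y' y] <;>
      norm_num
  obtain ⟨δ, hδ, heq⟩ := hG.exists_isometry h3
  have hδ0 : δ 0 = p := heq (0, p) (by simp)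
  have hδ1 : δ 1 = y := heq (1, y) (by simp)
  have hδ2 : δ (-1) = y' := heq (-1, y') (by simp)
  obtain ⟨v, hv1, hv, hv'⟩ := exists_localVelocity hsm hδ hδ0
  have h6 : diffAt (coshFun c y) p v = diffAt (coshFun c y) p u := by
    rw [← hodd', ← oddCoeff_eq_diffAt hsm hB hδ hδ0 hv, oddCoeff_apply, hδ1, hδ2]
  rw [← hδ1, hv', hv', real_inner_self_eq_norm_mul_norm, hv1] at h6
  have h7 : inner ℝ v u = 1 := by
    have := sinh_one_pos
    have h8 := mul_left_cancel₀ (neg_ne_zero.2 this.ne') h6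
    linarith
  have h9 : v = u := (inner_eq_one_iff_of_norm_eq_one hv1 hu).1 h7
  exact ⟨δ, hδ, hδ0, h9 ▸ hv⟩

end Surjective
end

noncomputable section

section Reflection

open Manifold

variable {n : ℕ} {M : Type*} [MetricSpace M] [ChartedSpace (EuclideanSpace ℝ (Fin n)) M] {c : ℝ}

theorem dEmbed_apply (p : M) (v : TangentSpace (𝓡 n) p) (q : M) :
    dEmbed n c p v q = diffAt (coshFun c q) p v := by
  have : (fun x : M => coshFun c x q) = coshFun c q := funext fun x => coshFun_symm c x q
  change mfderiv (𝓡 n) 𝓘(ℝ, ℝ) (fun x : M => coshFun c x q) p v = _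
  rw [this]
  rfl

theorem formB_oddCoeff (γ : ℝ → M) (h : radialSpan M c) :
    formB c (oddCoeff c γ) h =
      (2 * Real.sinh 1)⁻¹ * ((h : M → ℝ) (γ 1) - (h : M → ℝ) (γ (-1))) := by
  simp [oddCoeff, formB_embed]

theorem mem_tangentIn {p : M} {h : radialSpan M c} :
    h ∈ tangentIn n c p ↔ ∃ v : TangentSpace (𝓡 n) p, dEmbed n c p v = h :=
  Iff.rfl

variable [RiemannianBundle (fun x : M => TangentSpace (𝓡 n) x)] [IsManifold (𝓡 n) ∞ M]
  [IsContMDiffRiemannianBundle (𝓡 n) ∞ (EuclideanSpace ℝ (Fin n))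
      (fun x : M => TangentSpace (𝓡 n) x)]
  [IsRiemannianManifold (𝓡 n) M]

theorem dEmbed_eq_oddCoeff (hsm : ∀ q : M, MDifferentiable (𝓡 n) 𝓘(ℝ, ℝ) (coshFun c q))
    (hB : FormNondegenerate M c) {γ : ℝ → M} (hγ : Isometry γ) {p : M} (h0 : γ 0 = p)
    {u : TangentSpace (𝓡 n) p} (hu : HasLocalVelocity γ p u) :
    dEmbed n c p u = oddCoeff c γ := by
  funext q
  rw [dEmbed_apply, oddCoeff_eq_diffAt hsm hB hγ h0 hu]

omit [IsManifold (𝓡 n) ∞ M] [IsContMDiffRiemannianBundle (𝓡 n) ∞ (EuclideanSpace ℝ (Fin n))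
  (fun x : M => TangentSpace (𝓡 n) x)] [IsRiemannianManifold (𝓡 n) M] in
theorem exists_unit_smul {p : M} {v : TangentSpace (𝓡 n) p} (hv : v ≠ 0) :
    ∃ u : TangentSpace (𝓡 n) p, ‖u‖ = 1 ∧ v = ‖v‖ • u := by
  have h := norm_ne_zero_iff.2 hv
  exact ⟨‖v‖⁻¹ • v, by rw [norm_smul, norm_inv, norm_norm, inv_mul_cancel₀ h],
    by rw [smul_smul, mul_inv_cancel₀ h, one_smul]⟩

theorem oddCoeff_mem_tangentIn (hsm : ∀ q : M, MDifferentiable (𝓡 n) 𝓘(ℝ, ℝ) (coshFun c q))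
    (hB : FormNondegenerate M c) {γ : ℝ → M} (hγ : Isometry γ) {p : M} (h0 : γ 0 = p) :
    oddCoeff c γ ∈ tangentIn n c p := by
  obtain ⟨u, -, hγu, hd⟩ := exists_localVelocity hsm hγ h0
  exact mem_tangentIn.2 ⟨u, dEmbed_eq_oddCoeff hsm hB hγ h0 hγu⟩

variable [ProperSpace M]

theorem dEmbed_mem_radialSpan (hsm : ∀ q : M, MDifferentiable (𝓡 n) 𝓘(ℝ, ℝ) (coshFun c q))
    (hB : FormNondegenerate M c) (h3 : HasThirdPoint M) (p : M) (v : TangentSpace (𝓡 n) p) :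
    dEmbed n c p v ∈ radialSpan M c := by
  rcases eq_or_ne v 0 with rfl | hv
  · rw [map_zero]; exact zero_mem _
  obtain ⟨u, hu1, hu⟩ := exists_unit_smul hv
  obtain ⟨γ, hγ, h0, hγu⟩ := exists_line_of_norm_eq_one hsm hB h3 hu1
  rw [hu, map_smul, dEmbed_eq_oddCoeff hsm hB hγ h0 hγu]
  exact Submodule.smul_mem _ _ (oddCoeff c γ).2

theorem formB_tangent (hsm : ∀ q : M, MDifferentiable (𝓡 n) 𝓘(ℝ, ℝ) (coshFun c q))
    (hB : FormNondegenerate M c) (h3 : HasThirdPoint M) {p : M} {v w : TangentSpace (𝓡 n) p}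
    {g h : radialSpan M c} (hg : dEmbed n c p v = g) (hh : dEmbed n c p w = h) :
    formB c g h = -inner ℝ v w := by
  rcases eq_or_ne v 0 with rfl | hv
  · have : g = 0 := Subtype.ext (by rw [← hg, map_zero]; rfl)
    rw [this, inner_zero_left]; simp
  obtain ⟨u, hu1, hu⟩ := exists_unit_smul hv
  obtain ⟨γ, hγ, h0, hγu⟩ := exists_line_of_norm_eq_one hsm hB h3 hu1
  obtain ⟨u', -, hγu', hd⟩ := exists_localVelocity hsm hγ h0
  obtain rfl : u' = u := tendsto_nhds_unique hγu' hγu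
  have hg' : g = ‖v‖ • oddCoeff c γ := Subtype.ext (by
    rw [← hg]
    nth_rw 1 [hu]
    rw [map_smul, dEmbed_eq_oddCoeff hsm hB hγ h0 hγu]
    rfl)
  have := sinh_one_pos.ne'
  rw [hg', map_smul, LinearMap.smul_apply, formB_oddCoeff, ← hh, dEmbed_apply, dEmbed_apply, hd, hd,
    Real.sinh_neg]
  nth_rw 2 [hu]
  rw [inner_smul_left, smul_eq_mul]
  simp only [conj_trivial]
  field_simp
  ring

theorem sub_oddCoeff_mem_normalIn (hsm : ∀ q : M, MDifferentiable (𝓡 n) 𝓘(ℝ, ℝ) (coshFun c q))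
    (hB : FormNondegenerate M c) (h3 : HasThirdPoint M) {γ : ℝ → M} (hγ : Isometry γ) {p : M}
    (h0 : γ 0 = p) (t : ℝ) :
    embed c (γ t) - Real.sinh t • oddCoeff c γ ∈ normalIn n c p := by
  obtain ⟨u, -, hγu, hd⟩ := exists_localVelocity hsm hγ h0
  rw [normalIn, LinearMap.BilinForm.mem_orthogonal_iff]
  intro h hh
  obtain ⟨w, hw⟩ := mem_tangentIn.1 hh
  rw [map_sub, map_smul, formB_embed_right, ← hw, dEmbed_apply, hd,
    formB_tangent hsm hB h3 hw (dEmbed_eq_oddCoeff hsm hB hγ h0 hγu), real_inner_comm]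
  simp

theorem isCompl_normalIn_tangentIn
    (hsm : ∀ q : M, MDifferentiable (𝓡 n) 𝓘(ℝ, ℝ) (coshFun c q))
    (hB : FormNondegenerate M c) (h3 : HasThirdPoint M) (p : M) :
    IsCompl (normalIn n c p) (tangentIn n c p) := by
  refine IsCompl.of_eq ?_ ?_
  · rw [Submodule.eq_bot_iff]
    rintro x ⟨hxN, hxT⟩
    obtain ⟨v, hv⟩ := mem_tangentIn.1 hxT
    have h1 := LinearMap.BilinForm.mem_orthogonal_iff.1 hxN x hxT
    rw [formB_tangent hsm hB h3 hv hv, neg_eq_zero, inner_self_eq_zero] at h1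
    rw [h1, map_zero] at hv
    exact Subtype.ext hv.symm
  · rw [Submodule.eq_top_iff']
    intro x
    induction x using radialSpan_induction with
    | hembed q =>
      obtain ⟨γ, hγ, h0, hq⟩ := h3.exists_line p q
      rw [← hq, ← sub_add_cancel (embed c (γ (dist p q)))
        (Real.sinh (dist p q) • oddCoeff c γ)]
      exact Submodule.add_mem_sup (sub_oddCoeff_mem_normalIn hsm hB h3 hγ h0 _)
        (Submodule.smul_mem _ _ (oddCoeff_mem_tangentIn hsm hB hγ h0))
    | hzero => exact zero_mem _
    | hadd g h hg hh => exact add_mem hg hh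
    | hsmul a g hg => exact Submodule.smul_mem _ _ hg

/-- The reflection in `N_p` exists, preserves `B`, and reverses the lines through `p`. -/
theorem exists_reflection (hsm : ∀ q : M, MDifferentiable (𝓡 n) 𝓘(ℝ, ℝ) (coshFun c q))
    (hB : FormNondegenerate M c) (h3 : HasThirdPoint M) (p : M) :
    ∃ τ : radialSpan M c ≃ₗ[ℝ] radialSpan M c, IsReflection n c p τ ∧
      (∀ g h, formB c (τ g) (τ h) = formB c g h) ∧ (∀ h, τ (τ h) = h) ∧
      ∀ γ : ℝ → M, Isometry γ → γ 0 = p → ∀ t, τ (embed c (γ t)) = embed c (γ (-t)) := by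
  have hc := isCompl_normalIn_tangentIn (n := n) hsm hB h3 p
  set P := (tangentIn n c p).projection (normalIn n c p) hc.symm with hP
  have hPT : ∀ h ∈ tangentIn n c p, P h = h := fun h hh =>
    Submodule.projection_apply_of_mem_left hc.symm hh
  have hPN : ∀ h ∈ normalIn n c p, P h = 0 := fun h hh =>
    (Submodule.projection_apply_eq_zero_iff hc.symm).2 hh
  have hPmem : ∀ h, P h ∈ tangentIn n c p := fun h => Submodule.projection_apply_mem hc.symm h
  have hsub : ∀ h, h - P h ∈ normalIn n c p := fun h => Submodule.sub_projection_mem hc.symm h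
  let T : radialSpan M c →ₗ[ℝ] radialSpan M c := LinearMap.id - (2 : ℝ) • P
  have hT : ∀ h, T h = h - (2 : ℝ) • P h := fun h => rfl
  have hinv : ∀ h, T (T h) = h := by
    intro h
    simp only [hT, map_sub, map_smul, hPT _ (hPmem h)]
    module
  have horth : ∀ g h, formB c (P g) h = formB c (P g) (P h) := by
    intro g h
    have := LinearMap.BilinForm.mem_orthogonal_iff.1 (hsub h) (P g) (hPmem g)
    rwa [map_sub, sub_eq_zero] at this
  have hTT : ∀ h ∈ tangentIn n c p, T h = -h := by
    intro h hh
    rw [hT, hPT h hh]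
    module
  have hTN : ∀ h ∈ normalIn n c p, T h = h := by
    intro h hh
    rw [hT, hPN h hh, smul_zero, sub_zero]
  refine ⟨LinearEquiv.ofInvolutive T hinv, ⟨hc, hTN, hTT⟩, ?_, hinv, ?_⟩
  · intro g h
    change formB c (T g) (T h) = _
    have e1 := horth g h
    have e2 : formB c g (P h) = formB c (P g) (P h) := by
      rw [formB_symm, horth, formB_symm]
    simp only [hT, map_sub, map_smul, LinearMap.sub_apply, LinearMap.smul_apply, smul_eq_mul, e1, e2]
    ring
  · intro γ hγ h0 t
    change T _ = _
    have e1 := hTN _ (sub_oddCoeff_mem_normalIn hsm hB h3 hγ h0 t)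
    have e2 := hTT _ (oddCoeff_mem_tangentIn hsm hB hγ h0)
    rw [map_sub, map_smul, e2, sub_eq_iff_eq_add] at e1
    rw [e1, hB.embed_line hγ t, hB.embed_line hγ (-t), Real.cosh_neg, Real.sinh_neg]
    module

end Reflection

section Involution

variable {M : Type*} [MetricSpace M] {c : ℝ} {p : M} [ProperSpace M]

/-- A form-preserving involution of `V_λ` that reverses the lines through `p` is induced by an
isometric involution of `M`. -/
theorem exists_isometryEquiv_of_reflection (h3 : HasThirdPoint M)
    {τ : radialSpan M c ≃ₗ[ℝ] radialSpan M c}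
    (hform : ∀ g h, formB c (τ g) (τ h) = formB c g h) (hinv : ∀ h, τ (τ h) = h)
    (hline : ∀ γ : ℝ → M, Isometry γ → γ 0 = p → ∀ t, τ (embed c (γ t)) = embed c (γ (-t))) :
    ∃ s : M ≃ᵢ M, (∀ q, τ (embed c q) = embed c (s q)) ∧
      ∀ γ : ℝ → M, Isometry γ → γ 0 = p → ∀ t, s (γ t) = γ (-t) := by
  have hex : ∀ q, ∃ q', τ (embed c q) = embed c q' := by
    intro q
    obtain ⟨γ, hγ, h0, hq⟩ := h3.exists_line p q
    exact ⟨γ (-dist p q), by rw [← hline γ hγ h0, hq]⟩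
  choose s hs using hex
  have hss : Function.Involutive s := fun q => by
    apply embed_injective (c := c)
    rw [← hs, ← hs, hinv]
  have hiso : Isometry s := Isometry.of_dist_eq fun q q' => by
    have h1 := hform (embed c q) (embed c q')
    rw [hs, hs, formB_embed_embed, formB_embed_embed, add_left_inj] at h1
    rw [← abs_of_nonneg (dist_nonneg (x := s q)), ← abs_of_nonneg (dist_nonneg (x := q))]
    exact le_antisymm (Real.cosh_le_cosh.1 h1.le) (Real.cosh_le_cosh.1 h1.ge)
  refine ⟨⟨hss.toPerm s, hiso⟩, hs, fun γ hγ h0 t => ?_⟩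
  apply embed_injective (c := c)
  rw [← hline γ hγ h0, hs]
  rfl

end Involution
end

noncomputable section

section Smooth

open Manifold Filter Topology

variable {n : ℕ} {M : Type*} [MetricSpace M] [ChartedSpace (EuclideanSpace ℝ (Fin n)) M] {c : ℝ}

theorem diffAt_comp {s : M → M} {p : M} (hs : MDifferentiableAt (𝓡 n) (𝓡 n) s p) {g : M → ℝ}
    (hg : MDifferentiableAt (𝓡 n) 𝓘(ℝ, ℝ) g (s p)) (v : TangentSpace (𝓡 n) p) :
    diffAt (g ∘ s) p v = diffAt g (s p) (mfderiv (𝓡 n) (𝓡 n) s p v) :=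
  congrArg (fun L : TangentSpace (𝓡 n) p →L[ℝ] ℝ => L v)
    (hg.hasMFDerivAt.comp p hs.hasMFDerivAt).mfderiv

theorem hasFDerivAt_chart {g : M → ℝ} {p : M} (hg : MDifferentiableAt (𝓡 n) 𝓘(ℝ, ℝ) g p) :
    HasFDerivAt (g ∘ (extChartAt (𝓡 n) p).symm)
      (show EuclideanSpace ℝ (Fin n) →L[ℝ] ℝ from diffAt g p) (extChartAt (𝓡 n) p p) := by
  have h : HasFDerivWithinAt (g ∘ (extChartAt (𝓡 n) p).symm)
    (show EuclideanSpace ℝ (Fin n) →L[ℝ] ℝ from diffAt g p) (range (𝓡 n))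
    (extChartAt (𝓡 n) p p) := hg.hasMFDerivAt.2
  rwa [modelWithCornersSelf_coe, range_id, hasFDerivWithinAt_univ] at h

/-- Finitely many smooth functions with jointly injective differentials detect smoothness. -/
theorem contMDiffAt_of_separating [IsManifold (𝓡 n) ∞ M] {s : M → M} {x : M}
    (hs : ContinuousAt s x) {g : Fin n → M → ℝ}
    (hg : ∀ i, ContMDiff (𝓡 n) 𝓘(ℝ, ℝ) ∞ (g i))
    (hgs : ∀ i, ContMDiffAt (𝓡 n) 𝓘(ℝ, ℝ) ∞ (g i ∘ s) x)
    (hsep : ∀ w : TangentSpace (𝓡 n) (s x), (∀ i, diffAt (g i) (s x) w = 0) → w = 0) :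
    ContMDiffAt (𝓡 n) (𝓡 n) ∞ s x := by
  rw [contMDiffAt_iff_target]
  refine ⟨hs, ?_⟩
  set φ := extChartAt (𝓡 n) (s x) with hφ
  let G : EuclideanSpace ℝ (Fin n) → Fin n → ℝ := fun z i => g i (φ.symm z)
  have hG : ContDiffAt ℝ ∞ G (φ (s x)) := by
    rw [contDiffAt_pi]
    intro i
    have h1 : ContMDiffAt 𝓘(ℝ, EuclideanSpace ℝ (Fin n)) 𝓘(ℝ, ℝ) ∞ (g i ∘ φ.symm) (φ (s x)) :=
      (hg i).contMDiffAt.comp _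
        ((contMDiffOn_extChartAt_symm (I := 𝓡 n) (n := ∞) (s x)).contMDiffAt
          (extChartAt_target_mem_nhds (s x)))
    exact h1.contDiffAt
  let L : EuclideanSpace ℝ (Fin n) →L[ℝ] (Fin n → ℝ) := ContinuousLinearMap.pi fun i =>
    (show EuclideanSpace ℝ (Fin n) →L[ℝ] ℝ from diffAt (g i) (s x))
  have hL : HasFDerivAt G L (φ (s x)) := hasFDerivAt_pi.2 fun i =>
    hasFDerivAt_chart ((hg i).mdifferentiable (by simp) (s x))
  have hinj : Function.Injective L := by
    rw [injective_iff_map_eq_zero]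
    intro w hw
    exact hsep w fun i => congrFun hw i
  let e : EuclideanSpace ℝ (Fin n) ≃L[ℝ] (Fin n → ℝ) :=
    (L.toLinearMap.linearEquivOfInjective hinj (by simp)).toContinuousLinearEquiv
  have he : HasFDerivAt G (e : EuclideanSpace ℝ (Fin n) →L[ℝ] (Fin n → ℝ)) (φ (s x)) := by
    have : (e : EuclideanSpace ℝ (Fin n) →L[ℝ] (Fin n → ℝ)) = L := rfl
    rwa [this]
  have hinvsm := hG.to_localInverse he (by simp)
  have hleft := (hG.hasStrictFDerivAt' he (by simp)).eventually_left_inverse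
  have hcoord : ContMDiffAt (𝓡 n) 𝓘(ℝ, Fin n → ℝ) ∞ (fun y i => g i (s y)) x :=
    contMDiffAt_pi_space.2 hgs
  have hGs : G (φ (s x)) = fun i => g i (s x) := by
    funext i
    simp only [G, hφ, extChartAt_to_inv]
  have hcomp : ContMDiffAt (𝓡 n) 𝓘(ℝ, EuclideanSpace ℝ (Fin n)) ∞
      (hG.localInverse he (by simp) ∘ fun y i => g i (s y)) x := by
    refine ContMDiffAt.comp x ?_ hcoord
    rw [← hGs]
    exact hinvsm.contMDiffAt
  refine hcomp.congr_of_eventuallyEq ?_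
  have hφs : Tendsto (fun y => φ (s y)) (𝓝 x) (𝓝 (φ (s x))) :=
    (continuousAt_extChartAt (I := 𝓡 n) (s x)).tendsto.comp hs
  filter_upwards [hφs.eventually hleft, hs (extChartAt_source_mem_nhds (I := 𝓡 n) (s x))]
    with y hy hys
  have : (fun i => g i (s y)) = G (φ (s y)) := by
    funext i
    simp only [G]
    rw [φ.left_inv hys]
  simp only [Function.comp_apply]
  rw [this]
  exact hy.symm

variable [RiemannianBundle (fun x : M => TangentSpace (𝓡 n) x)] [IsManifold (𝓡 n) ∞ M]
  [IsContMDiffRiemannianBundle (𝓡 n) ∞ (EuclideanSpace ℝ (Fin n))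
      (fun x : M => TangentSpace (𝓡 n) x)]
  [IsRiemannianManifold (𝓡 n) M] [ProperSpace M]

theorem eq_of_diffAt_coshFun_eq (hsm : ∀ q : M, MDifferentiable (𝓡 n) 𝓘(ℝ, ℝ) (coshFun c q))
    (hB : FormNondegenerate M c) (h3 : HasThirdPoint M) {p : M} {v w : TangentSpace (𝓡 n) p}
    (h : ∀ q, diffAt (coshFun c q) p v = diffAt (coshFun c q) p w) : v = w := by
  rw [← sub_eq_zero]
  by_contra hne
  obtain ⟨u, hu1, hu⟩ := exists_unit_smul hne
  obtain ⟨γ, hγ, h0, hγu⟩ := exists_line_of_norm_eq_one hsm hB h3 hu1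
  obtain ⟨u', -, hγu', hd⟩ := exists_localVelocity hsm hγ h0
  obtain rfl : u' = u := tendsto_nhds_unique hγu' hγu
  have h1 := hd 1 (v - w)
  rw [map_sub, h, sub_self, hu, inner_smul_right, real_inner_self_eq_norm_mul_norm, hu1] at h1
  have := mul_pos sinh_one_pos (norm_pos_iff.2 hne)
  linarith

theorem isometryEquiv_contMDiff (hsm : ∀ q : M, ContMDiff (𝓡 n) 𝓘(ℝ, ℝ) ∞ (coshFun c q))
    (hB : FormNondegenerate M c) (h3 : HasThirdPoint M) (s : M ≃ᵢ M) :
    ContMDiff (𝓡 n) (𝓡 n) ∞ s := by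
  have hsm' : ∀ q : M, MDifferentiable (𝓡 n) 𝓘(ℝ, ℝ) (coshFun c q) :=
    fun q => (hsm q).mdifferentiable (by simp)
  intro x
  have hcomp : ∀ q, coshFun c q ∘ s = coshFun c (s.symm q) := by
    intro q
    funext y
    simp only [Function.comp_apply, coshFun]
    rw [← s.isometry.dist_eq (s.symm q) y, s.apply_symm_apply]
  choose γ hγ h0 hγu using fun i : Fin n =>
    exists_line_of_norm_eq_one hsm' hB h3 ((orthoFrame (n := n) (s x)).orthonormal.1 i)
  refine contMDiffAt_of_separating (g := fun i => coshFun c (γ i 1)) s.continuous.continuousAt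
    (fun i => hsm _) (fun i => by rw [hcomp]; exact hsm _ x) fun w hw => ?_
  refine (orthoFrame (n := n) (s x)).repr.injective (PiLp.ext fun i => ?_)
  obtain ⟨u', -, hγu', hd⟩ := exists_localVelocity hsm' (hγ i) (h0 i)
  obtain rfl := tendsto_nhds_unique hγu' (hγu i)
  have h1 := (hd 1 w).symm.trans (hw i)
  have := sinh_one_pos.ne'
  rw [map_zero, OrthonormalBasis.repr_apply_apply]
  simpa [this] using h1

/-- Metric isometries are smooth. -/
def IsometryEquiv.toDiffeomorph (hsm : ∀ q : M, ContMDiff (𝓡 n) 𝓘(ℝ, ℝ) ∞ (coshFun c q))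
    (hB : FormNondegenerate M c) (h3 : HasThirdPoint M) (s : M ≃ᵢ M) : M ≃ₘ⟮𝓡 n, 𝓡 n⟯ M where
  toEquiv := s.toEquiv
  contMDiff_toFun := isometryEquiv_contMDiff hsm hB h3 s
  contMDiff_invFun := isometryEquiv_contMDiff hsm hB h3 s.symm

theorem norm_mfderiv_isometry (hsm : ∀ q : M, MDifferentiable (𝓡 n) 𝓘(ℝ, ℝ) (coshFun c q))
    (hB : FormNondegenerate M c) (h3 : HasThirdPoint M) {s : M → M} (hs : Isometry s)
    (hsd : MDifferentiable (𝓡 n) (𝓡 n) s) (p : M) (v : TangentSpace (𝓡 n) p) :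
    ‖mfderiv (𝓡 n) (𝓡 n) s p v‖ = ‖v‖ := by
  rcases eq_or_ne v 0 with rfl | hv
  · rw [map_zero, norm_zero, norm_zero]
  obtain ⟨u, hu1, hu⟩ := exists_unit_smul hv
  obtain ⟨γ, hγ, h0, hγu⟩ := exists_line_of_norm_eq_one hsm hB h3 hu1
  obtain ⟨u', hu1', hγu', -⟩ := exists_localVelocity hsm (hs.comp hγ) (p := s p)
    (congrArg s h0)
  have key : mfderiv (𝓡 n) (𝓡 n) s p u = u' := by
    refine eq_of_diffAt_coshFun_eq hsm hB h3 fun q => ?_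
    rw [← diffAt_comp (hsd p) (hsm q (s p))]
    exact (hγu.hasDerivAt hγ h0 ((hsm q (s p)).comp p (hsd p))).unique
      (hγu'.hasDerivAt (hs.comp hγ) (congrArg s h0) (hsm q (s p)))
  rw [hu, map_smul, norm_smul, norm_smul, key, hu1', hu1]

theorem inner_mfderiv_isometry (hsm : ∀ q : M, MDifferentiable (𝓡 n) 𝓘(ℝ, ℝ) (coshFun c q))
    (hB : FormNondegenerate M c) (h3 : HasThirdPoint M) {s : M → M} (hs : Isometry s)
    (hsd : MDifferentiable (𝓡 n) (𝓡 n) s) (p : M) (u v : TangentSpace (𝓡 n) p) :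
    inner ℝ (mfderiv (𝓡 n) (𝓡 n) s p u) (mfderiv (𝓡 n) (𝓡 n) s p v) = inner ℝ u v :=
  (LinearMap.norm_map_iff_inner_map_map (𝕜 := ℝ) (mfderiv (𝓡 n) (𝓡 n) s p)).1
    (norm_mfderiv_isometry hsm hB h3 hs hsd p) u v

theorem diffAt_coshFun_mfderiv_reversal
    (hsm : ∀ q : M, MDifferentiable (𝓡 n) 𝓘(ℝ, ℝ) (coshFun c q))
    (hB : FormNondegenerate M c) (h3 : HasThirdPoint M) {s : M → M}
    {p : M} (hsd : MDifferentiableAt (𝓡 n) (𝓡 n) s p)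
    (hrev : ∀ γ : ℝ → M, Isometry γ → γ 0 = p → ∀ t, s (γ t) = γ (-t))
    (v : TangentSpace (𝓡 n) p) (q : M) :
    diffAt (coshFun c q) (s p) (mfderiv (𝓡 n) (𝓡 n) s p v) = diffAt (coshFun c q) p (-v) := by
  rw [← diffAt_comp hsd (hsm q (s p)), map_neg]
  rcases eq_or_ne v 0 with rfl | hv
  · rw [map_zero, map_zero, neg_zero]
  obtain ⟨u, hu1, hu⟩ := exists_unit_smul hv
  obtain ⟨γ, hγ, h0, hγu⟩ := exists_line_of_norm_eq_one hsm hB h3 hu1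
  have h1 := hγu.hasDerivAt hγ h0 ((hsm q (s p)).comp p hsd)
  have h2 : HasDerivAt (fun t => (coshFun c q ∘ γ) (-t)) (-diffAt (coshFun c q) p u) 0 := by
    have h4 : HasDerivAt (coshFun c q ∘ γ) (diffAt (coshFun c q) p u) (-0) := by
      rw [neg_zero]; exact hγu.hasDerivAt hγ h0 (hsm q p)
    have h5 := h4.scomp (0 : ℝ) (hasDerivAt_neg (0 : ℝ))
    rw [neg_one_smul] at h5
    exact h5
  have e : (coshFun c q ∘ s) ∘ γ = fun t => (coshFun c q ∘ γ) (-t) := by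
    funext t
    simp only [Function.comp_apply]
    rw [hrev γ hγ h0]
  rw [e] at h1
  rw [hu, map_smul, map_smul, h1.unique h2, smul_neg]

theorem eq_of_diffAt_coshFun_eq' (hsm : ∀ q : M, MDifferentiable (𝓡 n) 𝓘(ℝ, ℝ) (coshFun c q))
    (hB : FormNondegenerate M c) (h3 : HasThirdPoint M) {p p' : M} (hp : p = p')
    {v : TangentSpace (𝓡 n) p} {w : TangentSpace (𝓡 n) p'}
    (h : ∀ q, diffAt (coshFun c q) p v = diffAt (coshFun c q) p' w) :
    (show EuclideanSpace ℝ (Fin n) from v) = (show EuclideanSpace ℝ (Fin n) from w) := by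
  subst hp
  exact eq_of_diffAt_coshFun_eq hsm hB h3 h

/-- The geodesic involution at `p` exists, is an isometry, and is induced by a reflection. -/
theorem exists_geodesicInvolution (hsm : ∀ q : M, ContMDiff (𝓡 n) 𝓘(ℝ, ℝ) ∞ (coshFun c q))
    (hB : FormNondegenerate M c) (h3 : HasThirdPoint M) (p : M) :
    ∃ (s : M ≃ₘ⟮𝓡 n, 𝓡 n⟯ M) (τ : radialSpan M c ≃ₗ[ℝ] radialSpan M c),
        IsRiemannianIsometry s ∧ IsGeodesicInvolution p s ∧
        IsReflection n c p τ ∧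
        (∀ g h : radialSpan M c, formB c (τ g) (τ h) = formB c g h) ∧
        ∀ q : M, τ (embed c q) = embed c (s q) := by
  have hsm' : ∀ q : M, MDifferentiable (𝓡 n) 𝓘(ℝ, ℝ) (coshFun c q) :=
    fun q => (hsm q).mdifferentiable (by simp)
  obtain ⟨τ, hτ, hform, hinv, hline⟩ := exists_reflection hsm' hB h3 p
  obtain ⟨s, hs, hrev⟩ := exists_isometryEquiv_of_reflection h3 hform hinv hline
  have hsd : MDifferentiable (𝓡 n) (𝓡 n) s :=
    (isometryEquiv_contMDiff hsm hB h3 s).mdifferentiable (by simp)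
  have hsp : s p = p := by
    obtain ⟨γ, hγ, h0, -⟩ := h3.exists_line p p
    have := hrev γ hγ h0 0
    rwa [neg_zero, h0] at this
  refine ⟨s.toDiffeomorph hsm hB h3, τ, inner_mfderiv_isometry hsm' hB h3 s.isometry hsd,
    ⟨hsp, fun v => ?_, fun γ hγ h0 t => hrev γ (hB.isometry_of_isGeodesic h3 hγ) h0 t⟩, hτ, hform,
    hs⟩
  exact eq_of_diffAt_coshFun_eq' hsm' hB h3 hsp
    (diffAt_coshFun_mfderiv_reversal hsm' hB h3 (hsd p) hrev v)

end Smooth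
end

theorem lemma3p1 (n : ℕ) (M : Type*) [MetricSpace M]
    [ChartedSpace (EuclideanSpace ℝ (Fin n)) M] [IsManifold (𝓡 n) ∞ M]
    [RiemannianBundle (fun x : M => TangentSpace (𝓡 n) x)]
    [IsContMDiffRiemannianBundle (𝓡 n) ∞ (EuclideanSpace ℝ (Fin n))
      (fun x : M => TangentSpace (𝓡 n) x)]
    [IsRiemannianManifold (𝓡 n) M] [CompleteSpace M] [NoncompactSpace M]
    (harm : IsHarmonic n M)
    (lam c : ℝ) (hlam : lam ≠ 0)
    (hne : ∀ p : M, ∃ f : M → ℝ, f ≠ 0 ∧ IsAveragedEigenfunction n lam p f)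
    (hcosh : ∀ (p : M) (f : M → ℝ), IsAveragedEigenfunction n lam p f →
      ∃ a : ℝ, f = a • coshFun c p)
    (hnondeg : ∀ γ : ℝ → M, IsGeodesic γ →
      ((formB c).restrict (curveSpan c γ)).Nondegenerate) :
    IsSymmetricSpace n M ∧
    ∀ p : M,
      (∀ v : TangentSpace (𝓡 n) p, dEmbed n c p v ∈ radialSpan M c) ∧
      ∃ (s : M ≃ₘ⟮𝓡 n, 𝓡 n⟯ M) (τ : radialSpan M c ≃ₗ[ℝ] radialSpan M c),
        IsRiemannianIsometry s ∧ IsGeodesicInvolution p s ∧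
        IsReflection n c p τ ∧
        (∀ g h : radialSpan M c, formB c (τ g) (τ h) = formB c g h) ∧
        ∀ q : M, τ (embed c q) = embed c (s q) := by
  have : LocallyCompactSpace M := Manifold.locallyCompact_of_finiteDimensional (𝓡 n)
  have : ProperSpace M := (hasApproxBetween_of_riemannian n M).properSpace
  have : Nontrivial M := by
    rw [← not_subsingleton_iff_nontrivial]
    intro hsub
    exact not_compactSpace_iff.2 ‹NoncompactSpace M› inferInstance
  have hsm : ∀ p : M, ContMDiff (𝓡 n) 𝓘(ℝ, ℝ) ∞ (coshFun c p) := by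
    intro p
    obtain ⟨f, hf0, hf⟩ := hne p
    obtain ⟨a, ha⟩ := hcosh p f hf
    have ha0 : a ≠ 0 := by
      rintro rfl
      exact hf0 (by rw [ha, zero_smul])
    have : coshFun c p = a⁻¹ • f := by rw [ha, smul_smul, inv_mul_cancel₀ ha0, one_smul]
    rw [this]
    exact (contMDiff_const (c := a⁻¹)).mul hf.1.1
  have hsm' : ∀ q : M, MDifferentiable (𝓡 n) 𝓘(ℝ, ℝ) (coshFun c q) :=
    fun q => (hsm q).mdifferentiable (by simp)
  have h3 : HasThirdPoint M := hasThirdPoint_of_mdifferentiable n hsm'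
  have main := exists_geodesicInvolution hsm hnondeg h3
  refine ⟨fun p => ?_, fun p => ⟨dEmbed_mem_radialSpan hsm' hnondeg h3 p, main p⟩⟩
  obtain ⟨s, τ, hs, hs', -⟩ := main p
  exact ⟨s, hs, hs'⟩
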